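/- Let $r\ge 3$ be an odd integer, let $q$ be a prime power with $q\equiv 1 \pmod{r+1}$, let $m\ge 1$ be an integer, and let $\mathbb{F}_{q^m}$ be the finite field with $q^m$ elements. Let $t$ be transcendental over $\mathbb{F}_{q^m}$, and let $\mathbb{F}_{q^m}(t,x)$ be the extension of the rational function field $\mathbb{F}_{q^m}(t)$ generated by a root $x$ of $$\mathcal{P}_t(T)=T^{r+1}+2T^{\frac{r+1}{2}}-T^3+T^2(t^{r+1}+1)-Tt^{r+1}+1\in\mathbb{F}_{q^m}(t)[T].$$ For a place $P$ of $\mathbb{F}_{q^m}(t,x)$ lying over the place $(t=\infty)$ of $\mathbb{F}_{q^m}(t)$, let $e(P|(t=\infty))$ denote its ramification index and $f(P|(t=\infty))$ its relative degree. Then: (1) If $-1$ is a square in $\mathbb{F}_{q^m}$, there are exactly four places of $\mathbb{F}_{q^m}(t,x)$ lying over $(t=\infty)$: two places $P_1,P_2$ with $e(P_i|(t=\infty))=1$ and $f(P_i|(t=\infty))=1$ for $i=1,2$, and two places $P_3,P_4$ with $e(P_i|(t=\infty))=\frac{r-1}{2}$ and $f(P_i|(t=\infty))=1$ for $i=3,4$.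 (2) If $-1$ is not a square in $\mathbb{F}_{q^m}$, there are exactly three places of $\mathbb{F}_{q^m}(t,x)$ lying over $(t=\infty)$: two places $P_1,P_2$ with $e(P_i|(t=\infty))=1$ and $f(P_i|(t=\infty))=1$ for $i=1,2$, and one place $P_3$ with $e(P_3|(t=\infty))=\frac{r-1}{2}$ and $f(P_3|(t=\infty))=2$. -/

import Mathlib

noncomputable section

open Polynomial

/-- A place of a field extension `F / K`, given by its valuation ring: a ring `O` with
`K ⊊ O ⊊ F` such that `z ∈ O` or `z⁻¹ ∈ O` for every `z ∈ F`. The place itself, as an ideal, is the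
maximal ideal of `O`. -/
@[ext]
structure Place (K F : Type*) [Field K] [Field F] [Algebra K F] where
  valuationRing : ValuationSubring F
  const_lt : (algebraMap K F).range < valuationRing.toSubring
  lt_top : valuationRing < ⊤

namespace Place

variable {K E F : Type*} [Field K] [Field E] [Field F] [Algebra K E] [Algebra K F] [Algebra E F]

/-- The maximal ideal of the valuation ring of a place. -/
def ideal (P : Place K F) : Ideal P.valuationRing :=
  IsLocalRing.maximalIdeal P.valuationRing

/-- `P` lies over `Q`: the valuation ring of `Q` is the intersection of the valuation ring of `P`
with the smaller field. -/
def LiesOver (P : Place K F) (Q : Place K E) : Prop :=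
  P.valuationRing.comap (algebraMap E F) = Q.valuationRing

/-- The type of the places of `F / K` lying over the place `Q` of `E / K`. -/
def Over (Q : Place K E) (F : Type*) [Field F] [Algebra K F] [Algebra E F] : Type _ :=
  {P : Place K F // P.LiesOver Q}

variable {Q : Place K E}

theorem Over.algebraMap_mem (P : Q.Over F) (z : Q.valuationRing) :
    algebraMap E F z ∈ P.1.valuationRing := by
  have h : (z : E) ∈ P.1.valuationRing.comap (algebraMap E F) := by
    rw [show P.1.valuationRing.comap (algebraMap E F) = Q.valuationRing from P.2]
    exact z.2
  exact h

/-- The inclusion of the valuation ring of `Q` in the valuation ring of a place over `Q`. -/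
def Over.inclusion (P : Q.Over F) : Q.valuationRing →+* P.1.valuationRing :=
  ((algebraMap E F).comp Q.valuationRing.subtype).codRestrict P.1.valuationRing.toSubring
    P.algebraMap_mem

/-- The ramification index `e(P | Q)`. -/
def Over.e (P : Q.Over F) : ℕ :=
  letI := P.inclusion.toAlgebra
  Ideal.ramificationIdx' Q.ideal P.1.ideal

/-- The relative degree `f(P | Q)`: the degree of the extension of residue fields. -/
def Over.f (P : Q.Over F) : ℕ :=
  letI := P.inclusion.toAlgebra
  Ideal.inertiaDeg' Q.ideal P.1.ideal

end Place

open Classical in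
/-- The place `(t = ∞)` of the rational function field `K(t)`, where `t = RatFunc.X`: its valuation
ring consists of the fractions `a / b` with `deg a ≤ deg b`. -/
def placeAtInfinity (K : Type*) [Field K] : Place K (RatFunc K) where
  valuationRing := (RatFunc.inftyValuation K).valuationSubring
  const_lt := by
    have hX : RatFunc.inftyValuation K (1 / RatFunc.X) = WithZero.exp (-1) :=
      RatFunc.inftyValuation.X_inv K
    refine lt_of_le_of_ne ?_ ?_
    · rintro _ ⟨k, rfl⟩
      change RatFunc.inftyValuation K (algebraMap K (RatFunc K) k) ≤ 1
      rcases eq_or_ne k 0 with rfl | hk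
      · simp
      · rw [RatFunc.algebraMap_eq_C, RatFunc.inftyValuation.C K hk]
    · intro h
      have hmem : (1 / RatFunc.X : RatFunc K) ∈
          (RatFunc.inftyValuation K).valuationSubring.toSubring := by
        change RatFunc.inftyValuation K (1 / RatFunc.X) ≤ 1
        rw [hX, ← WithZero.exp_zero, WithZero.exp_le_exp]
        norm_num
      rw [← h] at hmem
      obtain ⟨k, hk⟩ := hmem
      rw [RatFunc.algebraMap_eq_C] at hk
      rw [← hk] at hX
      rcases eq_or_ne k 0 with rfl | hk0
      · rw [map_zero, map_zero] at hX
        exact WithZero.exp_ne_zero hX.symm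
      · rw [RatFunc.inftyValuation.C K hk0, ← WithZero.exp_zero, WithZero.exp_inj] at hX
        norm_num at hX
  lt_top := by
    refine lt_top_iff_ne_top.2 fun h => ?_
    have hmem : (RatFunc.X : RatFunc K) ∈ (RatFunc.inftyValuation K).valuationSubring := by
      rw [h]; trivial
    have hle : RatFunc.inftyValuation K RatFunc.X ≤ 1 := hmem
    rw [RatFunc.inftyValuation.X, ← WithZero.exp_zero, WithZero.exp_le_exp] at hle
    norm_num at hle

/-- The polynomial
`P_t(T) = T^(r+1) + 2 T^((r+1)/2) - T^3 + T^2 (t^(r+1) + 1) - T t^(r+1) + 1` over `K(t)`. -/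
def curvePoly (K : Type*) [Field K] (r : ℕ) : (RatFunc K)[X] :=
  X ^ (r + 1) + 2 * X ^ ((r + 1) / 2) - X ^ 3 + X ^ 2 * C ((RatFunc.X : RatFunc K) ^ (r + 1) + 1)
    - X * C ((RatFunc.X : RatFunc K) ^ (r + 1)) + 1

end

/-! Put r + 1 = 2e + 4 and read the equation as t^(2e+4) x(x-1) = -N(x), where N(0) = 1 and N(1) = 4
≠ 0 because q is odd. Then F = K(x, t), x is transcendental over K, and a pole of t is a zero of x,
a zero of x - 1 or a pole of x (`valuationRing_mem`). At x = 0 and x = 1 the function t^(2e+4) of x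
has a simple pole, so these places of K(x) are totally ramified in F and 1/t is a uniformizer: e = f
= 1.

At x = ∞ the element w = t^(e+2)(x-1)/x^(e+2) (`curveW`) satisfies w² ≡ -1. Hence this place splits
in K(x, w) if -1 is a square and is inert otherwise. Since (x/t)^(e+2) w = x - 1, each place so
obtained is totally ramified of degree e+2 in F, with uniformizer t/x, and t has a pole of order e+1
= (r-1)/2.

All of this is proved through leading terms. Fix a set S of valuation rings with the same local
description and a parameter u with a pole at each of them. Suppose every nonzero z is c u^k up to
smaller terms, with the same c in C and the same k at all rings in S (`Led`). Then z lies in a ring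
of S iff z = 0 or k ≤ 0, so S has only one member (`eq_of_mem`), 1/u is a uniformizer
(`valuation_le_inv`) and C represents the residue field (`exists_residue`). Such leading terms come
from writing z = Σ a_i t^i with exponents in distinct residue classes, so that nothing cancels
(`led_sum_pow`). That S is nonempty follows by dominating a proper ideal by a valuation ring. -/

open Polynomial

/-! ### Calculus of leading terms. -/

section LeadingTerms

variable {K F : Type*} [Field K] [Field F] [Algebra K F]

/-- At every valuation ring in `S`, the element `z` is congruent to `c * u ^ k` modulo terms that are
smaller than `u ^ k`. -/
def HasLead (S : Set (ValuationSubring F)) (u z : F) (k : ℤ) (c : F) : Prop :=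
  ∀ O ∈ S, O.valuation (z / u ^ k - c) < 1

/-- `u` has a pole at every valuation ring in `S`, and the elements of `C` represent a subfield of
each of the residue fields, in a way that does not depend on the valuation ring. -/
structure LeadSystem (S : Set (ValuationSubring F)) (C : AddSubgroup F) (u : F) : Prop where
  nonempty : S.Nonempty
  one_lt : ∀ O ∈ S, 1 < O.valuation u
  le_one : ∀ O ∈ S, ∀ c ∈ C, O.valuation c ≤ 1
  one_mem : (1 : F) ∈ C
  mul : ∀ c ∈ C, ∀ c' ∈ C, ∃ c'' ∈ C, ∀ O ∈ S, O.valuation (c * c' - c'') < 1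
  inv : ∀ c ∈ C, c ≠ 0 → ∃ c' ∈ C, ∀ O ∈ S, O.valuation (c * c' - 1) < 1

/-- `z` is zero, or it has a leading term with coefficient in `C` and an exponent satisfying `R`. -/
def Led (S : Set (ValuationSubring F)) (C : AddSubgroup F) (u : F) (R : ℤ → Prop) (z : F) : Prop :=
  z = 0 ∨ ∃ k c, R k ∧ c ∈ C ∧ c ≠ 0 ∧ HasLead S u z k c

variable {S : Set (ValuationSubring F)} {C : AddSubgroup F} {u : F}

theorem ValuationSubring.valuation_mul_sub_lt_one {O : ValuationSubring F} {a b c d e : F}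
    (hb : O.valuation b ≤ 1) (hc : O.valuation c ≤ 1) (h1 : O.valuation (a - c) < 1)
    (h2 : O.valuation (b - d) < 1) (h3 : O.valuation (c * d - e) < 1) :
    O.valuation (a * b - e) < 1 := by
  have h : a * b - e = (a - c) * b + c * (b - d) + (c * d - e) := by ring
  rw [h]
  refine O.valuation.map_add_lt (O.valuation.map_add_lt ?_ ?_) h3
  · rw [map_mul]; exact mul_lt_one_of_lt_of_le h1 hb
  · rw [map_mul, mul_comm]; exact mul_lt_one_of_lt_of_le h2 hc

namespace LeadSystem

variable (h : LeadSystem S C u)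
include h

theorem ne_zero : u ≠ 0 := by
  obtain ⟨O, hO⟩ := h.nonempty
  rintro rfl
  simpa using h.one_lt O hO

theorem valuation_eq_one {c : F} (hc : c ∈ C) (hc0 : c ≠ 0) {O : ValuationSubring F} (hO : O ∈ S) :
    O.valuation c = 1 := by
  obtain ⟨c', hc', h1⟩ := h.inv c hc hc0
  have h2 : O.valuation (c * c') = 1 := by
    have := O.valuation.map_add_eq_of_lt_right (x := c * c' - 1) (y := 1) (by simpa using h1 O hO)
    simpa using this
  rw [map_mul] at h2
  refine le_antisymm (h.le_one O hO c hc) ?_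
  rw [← h2]
  exact mul_le_of_le_one_right' (h.le_one O hO c' hc')

theorem valuation_of_hasLead {z c : F} {k : ℤ} (hc : c ∈ C) (hc0 : c ≠ 0) (hz : HasLead S u z k c)
    {O : ValuationSubring F} (hO : O ∈ S) : O.valuation z = O.valuation u ^ k := by
  have h1 := h.valuation_eq_one hc hc0 hO
  have h2 : O.valuation (z / u ^ k) = 1 := by
    have := O.valuation.map_add_eq_of_lt_right (x := z / u ^ k - c) (y := c)
      (by rw [h1]; exact hz O hO)
    simpa [h1] using this
  rw [map_div₀, map_zpow₀, div_eq_one_iff_eq] at h2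
  · exact h2
  · exact zpow_ne_zero _ ((O.valuation.ne_zero_iff).2 h.ne_zero)

theorem div_valuation_le_one {z c : F} {k : ℤ} (hc : c ∈ C) (hz : HasLead S u z k c)
    {O : ValuationSubring F} (hO : O ∈ S) : O.valuation (z / u ^ k) ≤ 1 := by
  have : z / u ^ k = (z / u ^ k - c) + c := by ring
  rw [this]
  exact O.valuation.map_add_le (hz O hO).le (h.le_one O hO c hc)

theorem hasLead_mul {z z' c c' : F} {k k' : ℤ} (hc : c ∈ C) (hc0 : c ≠ 0) (hc' : c' ∈ C)
    (hc0' : c' ≠ 0) (hz : HasLead S u z k c) (hz' : HasLead S u z' k' c') :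
    ∃ c'' ∈ C, c'' ≠ 0 ∧ HasLead S u (z * z') (k + k') c'' := by
  obtain ⟨c'', hc'', h1⟩ := h.mul c hc c' hc'
  refine ⟨c'', hc'', ?_, fun O hO ↦ ?_⟩
  · rintro rfl
    obtain ⟨O, hO⟩ := h.nonempty
    have := h1 O hO
    rw [sub_zero, map_mul, h.valuation_eq_one hc hc0 hO, h.valuation_eq_one hc' hc0' hO] at this
    simp at this
  · have h2 : z * z' / u ^ (k + k') = z / u ^ k * (z' / u ^ k') := by
      rw [zpow_add₀ h.ne_zero]; field_simp
    rw [h2]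
    exact ValuationSubring.valuation_mul_sub_lt_one (h.div_valuation_le_one hc' hz' hO)
      (h.le_one O hO c hc) (hz O hO) (hz' O hO) (h1 O hO)

theorem hasLead_inv {z c : F} {k : ℤ} (hc : c ∈ C) (hc0 : c ≠ 0) (hz : HasLead S u z k c) :
    ∃ c' ∈ C, c' ≠ 0 ∧ HasLead S u z⁻¹ (-k) c' := by
  obtain ⟨c', hc', h1⟩ := h.inv c hc hc0
  refine ⟨c', hc', ?_, fun O hO ↦ ?_⟩
  · rintro rfl
    obtain ⟨O, hO⟩ := h.nonempty
    simpa using h1 O hO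
  · have hz0 : z ≠ 0 := by
      rintro rfl
      have := h.valuation_of_hasLead hc hc0 hz hO
      rw [map_zero] at this
      exact zpow_ne_zero _ ((O.valuation.ne_zero_iff).2 h.ne_zero) this.symm
    have hu := h.ne_zero
    have h2 : z⁻¹ / u ^ (-k) - c' =
        -((z / u ^ k)⁻¹ * ((z / u ^ k - c) * c' + (c * c' - 1))) := by
      rw [zpow_neg]
      have : u ^ k ≠ 0 := zpow_ne_zero _ hu
      field_simp
      ring
    have h3 : O.valuation (z / u ^ k) = 1 := by
      rw [map_div₀, map_zpow₀, h.valuation_of_hasLead hc hc0 hz hO, div_self]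
      exact zpow_ne_zero _ ((O.valuation.ne_zero_iff).2 hu)
    rw [h2, Valuation.map_neg, map_mul, map_inv₀, h3, inv_one, one_mul]
    refine O.valuation.map_add_lt ?_ (h1 O hO)
    rw [map_mul]
    exact mul_lt_one_of_lt_of_le (hz O hO) (h.le_one O hO c' hc')

theorem hasLead_add_of_lt {z z' c c' : F} {k k' : ℤ} (hc' : c' ∈ C) (hc0' : c' ≠ 0)
    (hz : HasLead S u z k c) (hz' : HasLead S u z' k' c') (hk : k' < k) :
    HasLead S u (z + z') k c := by
  intro O hO
  have : (z + z') / u ^ k - c = (z / u ^ k - c) + z' / u ^ k := by ring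
  rw [this]
  refine O.valuation.map_add_lt (hz O hO) ?_
  have hu : O.valuation u ≠ 0 := (O.valuation.ne_zero_iff).2 h.ne_zero
  rw [map_div₀, map_zpow₀, h.valuation_of_hasLead hc' hc0' hz' hO, ← zpow_sub₀ hu]
  exact zpow_lt_one_of_neg₀ (h.one_lt O hO) (by omega)

omit h in
theorem hasLead_add {z z' c c' : F} {k : ℤ} (hz : HasLead S u z k c) (hz' : HasLead S u z' k c') :
    HasLead S u (z + z') k (c + c') := by
  intro O hO
  have : (z + z') / u ^ k - (c + c') = (z / u ^ k - c) + (z' / u ^ k - c') := by ring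
  rw [this]
  exact O.valuation.map_add_lt (hz O hO) (hz' O hO)

omit h in
theorem hasLead_of_mem {c : F} : HasLead S u c 0 c := by
  intro O hO
  simp

theorem hasLead_self : HasLead S u u 1 1 := by
  intro O hO
  simp [h.ne_zero]

theorem led_mul {R R' R'' : ℤ → Prop} (hR : ∀ k k', R k → R' k' → R'' (k + k')) {z z' : F}
    (hz : Led S C u R z) (hz' : Led S C u R' z') : Led S C u R'' (z * z') := by
  obtain rfl | ⟨k, c, hk, hc, hc0, hz⟩ := hz
  · simp [Led]
  obtain rfl | ⟨k', c', hk', hc', hc0', hz'⟩ := hz'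
  · simp [Led]
  obtain ⟨c'', h1, h2, h3⟩ := h.hasLead_mul hc hc0 hc' hc0' hz hz'
  exact Or.inr ⟨_, c'', hR k k' hk hk', h1, h2, h3⟩

theorem led_inv {R R' : ℤ → Prop} (hR : ∀ k, R k → R' (-k)) {z : F}
    (hz : Led S C u R z) : Led S C u R' z⁻¹ := by
  obtain rfl | ⟨k, c, hk, hc, hc0, hz⟩ := hz
  · simp [Led]
  obtain ⟨c'', h1, h2, h3⟩ := h.hasLead_inv hc hc0 hz
  exact Or.inr ⟨_, c'', hR k hk, h1, h2, h3⟩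

theorem led_one {R : ℤ → Prop} (hR : R 0) : Led S C u R 1 :=
  Or.inr ⟨0, 1, hR, h.one_mem, one_ne_zero, hasLead_of_mem⟩

theorem led_pow {k₀ : ℤ} {z : F} (hz : Led S C u (· = k₀) z) (j : ℕ) :
    Led S C u (· = k₀ * j) (z ^ j) := by
  induction j with
  | zero => simpa using h.led_one (R := (· = 0)) rfl
  | succ j ih =>
    rw [pow_succ]
    refine h.led_mul ?_ ih hz
    rintro k k' rfl rfl
    push_cast
    ring

theorem led_zpow {k₀ : ℤ} {z : F} (hz : Led S C u (· = k₀) z) (j : ℤ) :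
    Led S C u (· = k₀ * j) (z ^ j) := by
  obtain ⟨m, rfl | rfl⟩ := j.eq_nat_or_neg
  · simpa using h.led_pow hz m
  · rw [zpow_neg, zpow_natCast]
    exact h.led_inv (by rintro k rfl; ring) (h.led_pow hz m)

/-- Disjointness of `R` and `R'` rules out equal exponents, so the leading terms cannot cancel. -/
theorem led_add {R R' R'' : ℤ → Prop} (hR : ∀ k, R k → R' k → False) (h1 : ∀ k, R k → R'' k)
    (h2 : ∀ k, R' k → R'' k) {z z' : F} (hz : Led S C u R z) (hz' : Led S C u R' z') :
    Led S C u R'' (z + z') := by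
  obtain rfl | ⟨k, c, hk, hc, hc0, hz⟩ := hz
  · obtain rfl | ⟨k', c', hk', hc', hc0', hz'⟩ := hz'
    · simp [Led]
    · exact Or.inr ⟨k', c', h2 _ hk', hc', hc0', by simpa using hz'⟩
  obtain rfl | ⟨k', c', hk', hc', hc0', hz'⟩ := hz'
  · exact Or.inr ⟨k, c, h1 _ hk, hc, hc0, by simpa using hz⟩
  rcases lt_trichotomy k k' with hkk | rfl | hkk
  · refine Or.inr ⟨k', c', h2 _ hk', hc', hc0', ?_⟩
    rw [add_comm]
    exact h.hasLead_add_of_lt hc hc0 hz' hz hkk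
  · exact (hR k hk hk').elim
  · exact Or.inr ⟨k, c, h1 _ hk, hc, hc0, h.hasLead_add_of_lt hc' hc0' hz hz' hkk⟩

theorem led_sum {ι : Type*} (s : Finset ι) {R : ι → ℤ → Prop} {f : ι → F}
    (hR : ∀ i ∈ s, ∀ j ∈ s, ∀ k, R i k → R j k → i = j) (hf : ∀ i ∈ s, Led S C u (R i) (f i)) :
    Led S C u (fun k ↦ ∃ i ∈ s, R i k) (∑ i ∈ s, f i) := by
  classical
  induction s using Finset.induction_on with
  | empty => exact Or.inl rfl
  | insert a s ha ih =>
    rw [Finset.sum_insert ha]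
    refine h.led_add (R := R a) (R' := fun k ↦ ∃ i ∈ s, R i k) ?_ ?_ ?_ (hf a (by simp))
      (ih (fun i hi j hj ↦ hR i (by simp [hi]) j (by simp [hj])) fun i hi ↦ hf i (by simp [hi]))
    · rintro k hk ⟨i, hi, hik⟩
      have := hR a (by simp) i (by simp [hi]) k hk hik
      exact ha (this ▸ hi)
    · exact fun k hk ↦ ⟨a, by simp, hk⟩
    · rintro k ⟨i, hi, hik⟩
      exact ⟨i, by simp [hi], hik⟩

omit h in
theorem led_mono {R R' : ℤ → Prop} (hR : ∀ k, R k → R' k) {z : F} (hz : Led S C u R z) :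
    Led S C u R' z :=
  hz.imp id fun ⟨k, c, hk, hc⟩ ↦ ⟨k, c, hR k hk, hc⟩

omit h in
theorem led_algebraMap (hK : ∀ a : K, algebraMap K F a ∈ C) (a : K) :
    Led S C u (· = 0) (algebraMap K F a) := by
  rcases eq_or_ne (algebraMap K F a) 0 with h0 | h0
  · exact Or.inl h0
  · exact Or.inr ⟨0, _, rfl, hK a, h0, hasLead_of_mem⟩

/-- The monomials of `p` evaluated at `y` have pairwise different exponents `k₀ * i`, so one of them
dominates. -/
theorem led_aeval (hK : ∀ a : K, algebraMap K F a ∈ C) {y : F} {k₀ : ℤ} (hk₀ : k₀ ≠ 0)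
    (hy : Led S C u (· = k₀) y) (p : K[X]) : Led S C u (k₀ ∣ ·) (aeval y p) := by
  rw [aeval_eq_sum_range]
  refine led_mono ?_ (h.led_sum (R := fun (i : ℕ) k ↦ k = k₀ * i) _ ?_ ?_)
  · rintro k ⟨i, -, rfl⟩
    exact dvd_mul_right _ _
  · rintro i - j - k rfl hij
    exact_mod_cast mul_left_cancel₀ hk₀ hij
  · intro i _
    rw [Algebra.smul_def]
    exact h.led_mul (by rintro k k' rfl rfl; ring) (led_algebraMap hK _) (h.led_pow hy i)

theorem led_adjoin (hK : ∀ a : K, algebraMap K F a ∈ C) {y : F} {k₀ : ℤ} (hk₀ : k₀ ≠ 0)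
    (hy : Led S C u (· = k₀) y) {z : F} (hz : z ∈ IntermediateField.adjoin K {y}) :
    Led S C u (k₀ ∣ ·) z := by
  obtain ⟨p, q, rfl⟩ := (IntermediateField.mem_adjoin_simple_iff K z).1 hz
  rw [div_eq_mul_inv]
  exact h.led_mul (fun _ _ ↦ dvd_add) (h.led_aeval hK hk₀ hy p)
    (h.led_inv (R' := (k₀ ∣ ·)) (fun k ↦ (dvd_neg (a := k₀) (b := k)).2) (h.led_aeval hK hk₀ hy q))

/-- The `i`-th term has an exponent congruent to `τ * i` modulo `d`. As `τ` is prime to `d`, these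
classes are distinct for `i < d`. This replaces the usual argument for total ramification. -/
theorem led_sum_pow {t : F} {τ : ℤ} {d : ℕ} (hτ : IsCoprime (d : ℤ) τ)
    (ht : Led S C u (· = τ) t) (a : ℕ → F) (ha : ∀ i, Led S C u ((d : ℤ) ∣ ·) (a i)) :
    Led S C u (fun _ ↦ True) (∑ i ∈ Finset.range d, a i * t ^ i) := by
  refine led_mono (fun _ _ ↦ trivial)
    (h.led_sum (R := fun (i : ℕ) k ↦ (d : ℤ) ∣ k - τ * i) _ ?_ fun i _ ↦ ?_)
  · intro i hi j hj k h1 h2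
    rw [Finset.mem_range] at hi hj
    have h3 : (d : ℤ) ∣ τ * ((i : ℤ) - j) := by
      have := dvd_sub h2 h1
      ring_nf at this ⊢
      exact this
    have h4 := hτ.dvd_of_dvd_mul_left h3
    obtain ⟨e, he⟩ := h4
    have : e = 0 := by
      by_contra h0
      rcases lt_or_gt_of_ne h0 with h0 | h0 <;> nlinarith
    subst this
    omega
  · refine h.led_mul ?_ (ha i) (h.led_pow ht i)
    rintro k k' hk rfl
    simpa using hk

/-- Change of the parameter in which leading terms are expressed. -/
theorem led_of_hasLead {y c z : F} {d j : ℤ} (hy : Led S C u (· = d) y) (hy0 : y ≠ 0)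
    (hc : c ∈ C) (hc0 : c ≠ 0) (hz : HasLead S y z j c) : Led S C u (d ∣ ·) z := by
  have hy' := h.led_zpow hy j
  have hyj : y ^ j ≠ 0 := zpow_ne_zero _ hy0
  have h1 : Led S C u (· = 0) (z / y ^ j) :=
    Or.inr ⟨0, c, rfl, hc, hc0, fun O hO ↦ by simpa using hz O hO⟩
  have := h.led_mul (R'' := (d ∣ ·)) (by rintro k k' rfl rfl; simp) h1 hy'
  rwa [div_mul_cancel₀ _ hyj] at this

section Unique

variable (hall : ∀ z, Led S C u (fun _ ↦ True) z)
include hall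

/-- Whether a nonzero `z` lies in a ring of `S` is decided by the sign of its exponent, which is the
same for all rings of `S`. -/
theorem eq_of_mem {O O' : ValuationSubring F} (hO : O ∈ S) (hO' : O' ∈ S) : O = O' := by
  ext z
  obtain rfl | ⟨k, c, -, hc, hc0, hz⟩ := hall z
  · simp
  rw [← O.valuation_le_one_iff, ← O'.valuation_le_one_iff, h.valuation_of_hasLead hc hc0 hz hO,
    h.valuation_of_hasLead hc hc0 hz hO', zpow_le_one_iff_right₀ (h.one_lt O hO),
    zpow_le_one_iff_right₀ (h.one_lt O' hO')]

theorem exists_residue {O : ValuationSubring F} (hO : O ∈ S) {z : F} (hz : O.valuation z ≤ 1) :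
    ∃ c ∈ C, O.valuation (z - c) < 1 := by
  obtain rfl | ⟨k, c, -, hc, hc0, hz'⟩ := hall z
  · exact ⟨0, C.zero_mem, by simp⟩
  rw [h.valuation_of_hasLead hc hc0 hz' hO, zpow_le_one_iff_right₀ (h.one_lt O hO)] at hz
  rcases hz.lt_or_eq with hk | rfl
  · refine ⟨0, C.zero_mem, ?_⟩
    rw [sub_zero, h.valuation_of_hasLead hc hc0 hz' hO]
    exact zpow_lt_one_of_neg₀ (h.one_lt O hO) hk
  · exact ⟨c, hc, by simpa using hz' O hO⟩

theorem valuation_le_inv {O : ValuationSubring F} (hO : O ∈ S) {z : F} (hz : O.valuation z < 1) :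
    O.valuation z ≤ O.valuation u⁻¹ := by
  obtain rfl | ⟨k, c, -, hc, hc0, hz'⟩ := hall z
  · simp
  rw [h.valuation_of_hasLead hc hc0 hz' hO, zpow_lt_one_iff_right₀ (h.one_lt O hO)] at hz
  rw [h.valuation_of_hasLead hc hc0 hz' hO, map_inv₀, ← zpow_neg_one]
  exact zpow_le_zpow_right₀ (h.one_lt O hO).le (by omega)

end Unique

end LeadSystem

end LeadingTerms

/-! ### Constant fields, and places as valuation rings. -/

section Constants

variable {K F : Type*} [Field K] [Field F] [Algebra K F]

theorem ValuationSubring.valuation_algebraMap {O : ValuationSubring F}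
    (hO : ∀ a : K, algebraMap K F a ∈ O) {a : K} (ha : a ≠ 0) :
    O.valuation (algebraMap K F a) = 1 := by
  refine le_antisymm ((O.valuation_le_one_iff _).2 (hO a)) ?_
  have h := (O.valuation_le_one_iff _).2 (hO a⁻¹)
  rw [map_inv₀, map_inv₀] at h
  have h0 : O.valuation (algebraMap K F a) ≠ 0 := by simpa using ha
  exact (inv_le_one₀ (zero_lt_iff.2 h0)).1 h

/-- The system whose coefficients are the constants. -/
theorem LeadSystem.of_const {S : Set (ValuationSubring F)} {u : F} (hS : S.Nonempty)
    (hK : ∀ O ∈ S, ∀ a : K, algebraMap K F a ∈ O) (hu : ∀ O ∈ S, 1 < O.valuation u) :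
    LeadSystem S (algebraMap K F).range.toAddSubgroup u where
  nonempty := hS
  one_lt := hu
  le_one := by
    rintro O hO _ ⟨a, rfl⟩
    exact (O.valuation_le_one_iff _).2 (hK O hO a)
  one_mem := (algebraMap K F).range.one_mem
  mul := fun c hc c' hc' ↦
    ⟨c * c', (algebraMap K F).range.mul_mem hc hc', fun O _ ↦ by simp⟩
  inv := by
    rintro _ ⟨a, rfl⟩ ha
    exact ⟨_, ⟨a⁻¹, rfl⟩, fun O _ ↦ by simp [mul_inv_cancel₀ ha]⟩

end Constants

namespace Place

variable {K E F : Type*} [Field K] [Field E] [Field F] [Algebra K E] [Algebra K F] [Algebra E F]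

theorem algebraMap_mem (P : Place K F) (a : K) : algebraMap K F a ∈ P.valuationRing :=
  P.const_lt.le ⟨a, rfl⟩

theorem mem_ideal {P : Place K F} {z : P.valuationRing} :
    z ∈ P.ideal ↔ P.valuationRing.valuation z < 1 :=
  P.valuationRing.valuation_lt_one_iff z

theorem LiesOver.valuation_le_one_iff {P : Place K F} {Q : Place K E} (h : P.LiesOver Q) (z : E) :
    P.valuationRing.valuation (algebraMap E F z) ≤ 1 ↔ Q.valuationRing.valuation z ≤ 1 := by
  rw [ValuationSubring.valuation_le_one_iff, ValuationSubring.valuation_le_one_iff,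
    ← show P.valuationRing.comap (algebraMap E F) = Q.valuationRing from h]
  rfl

theorem LiesOver.valuation_lt_one_iff {P : Place K F} {Q : Place K E} (h : P.LiesOver Q) (z : E) :
    P.valuationRing.valuation (algebraMap E F z) < 1 ↔ Q.valuationRing.valuation z < 1 := by
  rcases eq_or_ne z 0 with rfl | hz
  · simp
  rw [Valuation.val_lt_one_iff _ hz, Valuation.val_lt_one_iff _ (by simpa using hz), ← not_le,
    ← not_le, ← map_inv₀ (algebraMap E F), h.valuation_le_one_iff]

end Place

/-! ### The place at infinity, and criteria for `e` and `f`. -/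

namespace placeAtInfinity

variable (K : Type*) [Field K]

theorem one_lt_valuation_X : 1 < (placeAtInfinity K).valuationRing.valuation RatFunc.X := by
  classical
  rw [← not_le, ValuationSubring.valuation_le_one_iff]
  intro h
  have hle : RatFunc.inftyValuation K RatFunc.X ≤ 1 := h
  rw [RatFunc.inftyValuation.X, ← WithZero.exp_zero, WithZero.exp_le_exp] at hle
  norm_num at hle

theorem leadSystem : LeadSystem {(placeAtInfinity K).valuationRing}
    (algebraMap K (RatFunc K)).range.toAddSubgroup RatFunc.X :=
  LeadSystem.of_const ⟨_, rfl⟩ (by rintro _ rfl; exact (placeAtInfinity K).algebraMap_mem)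
    (by rintro _ rfl; exact one_lt_valuation_X K)

/-- The leading-term calculus applied to K(t) itself: 1/t is a uniformizer at infinity, and the
residue field is K. -/
theorem led (z : RatFunc K) : Led {(placeAtInfinity K).valuationRing}
    (algebraMap K (RatFunc K)).range.toAddSubgroup RatFunc.X (fun _ ↦ True) z :=
  LeadSystem.led_mono (fun _ _ ↦ trivial) ((leadSystem K).led_adjoin (fun a ↦ ⟨a, rfl⟩) one_ne_zero
    (Or.inr ⟨1, 1, rfl, (leadSystem K).one_mem, one_ne_zero, (leadSystem K).hasLead_self⟩)
    (by rw [RatFunc.adjoin_X]; trivial))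

variable {K} {F : Type*} [Field F] [Algebra K F] [Algebra (RatFunc K) F]

/-- A valuation on K(t) that is trivial on K and exceeds 1 at t is equivalent to the degree
valuation. -/
theorem liesOver_iff [IsScalarTower K (RatFunc K) F] (P : Place K F) :
    P.LiesOver (placeAtInfinity K) ↔
      1 < P.valuationRing.valuation (algebraMap (RatFunc K) F RatFunc.X) := by
  classical
  constructor
  · intro h
    rw [← not_le, h.valuation_le_one_iff, not_le]
    exact one_lt_valuation_X K
  · intro h
    let v := P.valuationRing.valuation.comap (algebraMap (RatFunc K) F)
    have hv : v.IsTrivialOn K := ⟨fun a ha ↦ by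
      change P.valuationRing.valuation (algebraMap (RatFunc K) F (algebraMap K (RatFunc K) a)) = 1
      rw [← IsScalarTower.algebraMap_apply]
      exact ValuationSubring.valuation_algebraMap P.algebraMap_mem ha⟩
    have := RatFunc.valuation_isEquiv_inftyValuation_of_one_lt_valuation_X (v := v) h
    ext z
    rw [ValuationSubring.mem_comap, ← ValuationSubring.valuation_le_one_iff]
    refine (Valuation.isEquiv_iff_val_le_one.1 this (x := z)).trans ?_
    rw [placeAtInfinity, Valuation.mem_valuationSubring_iff]

/-- The place over `(t = ∞)` given by a valuation ring that contains the constants and at which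
`t` has a pole. -/
def overOfPole [IsScalarTower K (RatFunc K) F] (O : ValuationSubring F)
    (hK : ∀ a : K, algebraMap K F a ∈ O)
    (ht : 1 < O.valuation (algebraMap (RatFunc K) F RatFunc.X)) : (placeAtInfinity K).Over F :=
  ⟨⟨O, by
    refine lt_of_le_of_ne (by rintro _ ⟨a, rfl⟩; exact hK a) fun h ↦ ?_
    have h1 : (algebraMap (RatFunc K) F RatFunc.X)⁻¹ ∈ O.toSubring :=
      (O.valuation_le_one_iff _).1 (by rw [map_inv₀]; exact inv_le_one_of_one_le₀ ht.le)
    rw [← h] at h1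
    obtain ⟨a, ha⟩ := h1
    have h2 : algebraMap (RatFunc K) F RatFunc.X = algebraMap K F a⁻¹ := by
      rw [map_inv₀, ha, inv_inv]
    rw [h2] at ht
    exact ht.not_ge ((O.valuation_le_one_iff _).2 (hK _)), by
    refine lt_top_iff_ne_top.2 fun h ↦ ht.not_ge ?_
    rw [O.valuation_le_one_iff, h]
    trivial⟩, (liesOver_iff _).2 ht⟩

variable (P : (placeAtInfinity K).Over F)

/-- Since 1/u generates the maximal ideal of `P`, its powers are described by the valuation. The
uniformizer 1/t at infinity has the value of u^(-ε), so it lies in the ε-th power and not in the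
next one. -/
theorem e_eq {u : F} {ε : ℕ} (hu1 : 1 < P.1.valuationRing.valuation u)
    (hu : ∀ z, P.1.valuationRing.valuation z < 1 →
      P.1.valuationRing.valuation z ≤ P.1.valuationRing.valuation u⁻¹)
    (ht : P.1.valuationRing.valuation (algebraMap (RatFunc K) F RatFunc.X) =
      P.1.valuationRing.valuation u ^ ε) : P.e = ε := by
  unfold Place.Over.e
  let := P.inclusion.toAlgebra
  have hmem : ∀ (n : ℕ) (z : P.1.valuationRing), z ∈ P.1.ideal ^ n ↔
      P.1.valuationRing.valuation z ≤ P.1.valuationRing.valuation u⁻¹ ^ n := by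
    have hu' : P.1.valuationRing.valuation u⁻¹ < 1 := by
      rw [map_inv₀]; exact inv_lt_one_of_one_lt₀ hu1
    let π : P.1.valuationRing := ⟨u⁻¹, (P.1.valuationRing.valuation_le_one_iff _).1 hu'.le⟩
    have hle : ∀ x y : P.1.valuationRing, y ∣ x ↔
        P.1.valuationRing.valuation x ≤ P.1.valuationRing.valuation y := by
      intro x y
      rw [ValuationSubring.valuation_le_iff]
      constructor
      · rintro ⟨a, rfl⟩; exact ⟨a, by push_cast; ring⟩
      · rintro ⟨a, ha⟩; exact ⟨a, Subtype.ext (by push_cast; rw [← ha]; ring)⟩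
    have hspan : P.1.ideal = Ideal.span {π} := by
      ext z
      rw [Place.mem_ideal, Ideal.mem_span_singleton, hle]
      exact ⟨hu z, fun h ↦ h.trans_lt hu'⟩
    intro n z
    rw [hspan, Ideal.span_singleton_pow, Ideal.mem_span_singleton, hle, ← map_pow]
    rfl
  have hX := one_lt_valuation_X K
  have hX0 : P.1.valuationRing.valuation u ≠ 0 := (zero_lt_one.trans hu1).ne'
  refine Ideal.ramificationIdx'_spec ?_ ?_
  · rw [Ideal.map_le_iff_le_comap]
    intro z hz
    rw [Ideal.mem_comap, hmem]
    rw [Place.mem_ideal] at hz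
    -- An element of the maximal ideal at infinity stays integral after multiplication by t.
    have h1 := (leadSystem K).valuation_le_inv (led K) rfl hz
    have h2 : (placeAtInfinity K).valuationRing.valuation ((z : RatFunc K) * RatFunc.X) ≤ 1 := by
      rw [map_mul]
      rw [map_inv₀] at h1
      calc _ ≤ _ := mul_le_mul_left h1 _
        _ = 1 := inv_mul_cancel₀ (zero_lt_one.trans hX).ne'
    rw [← P.2.valuation_le_one_iff, map_mul, map_mul, ht] at h2
    rw [map_inv₀, inv_pow]
    rw [← one_mul (_ ^ ε)⁻¹]
    exact (le_mul_inv_iff₀ (pow_pos (zero_lt_iff.2 hX0) ε)).2 h2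
  · rw [Ideal.map_le_iff_le_comap]
    intro h
    have hXinv : (placeAtInfinity K).valuationRing.valuation (RatFunc.X⁻¹) < 1 := by
      rw [map_inv₀]; exact inv_lt_one_of_one_lt₀ hX
    have h1 := @h ⟨RatFunc.X⁻¹, (ValuationSubring.valuation_le_one_iff _ _).1 hXinv.le⟩
      (Place.mem_ideal.2 hXinv)
    rw [Ideal.mem_comap, hmem] at h1
    change P.1.valuationRing.valuation (algebraMap (RatFunc K) F RatFunc.X⁻¹) ≤ _ at h1
    rw [map_inv₀, map_inv₀, ht, map_inv₀, inv_pow, inv_le_inv₀ (pow_pos (zero_lt_iff.2 hX0) _)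
      (pow_pos (zero_lt_iff.2 hX0) _), pow_le_pow_iff_right₀ hu1] at h1
    omega

/-- The residue field at infinity consists of the classes of constants, so the two conditions with
coefficients in `K` say that the residues of `b` form a basis. -/
theorem f_eq [IsScalarTower K (RatFunc K) F] {ι : Type*} [Fintype ι] (b : ι → F)
    (hb : ∀ i, b i ∈ P.1.valuationRing)
    (hspan : ∀ z ∈ P.1.valuationRing, ∃ a : ι → K,
      P.1.valuationRing.valuation (z - ∑ i, algebraMap K F (a i) * b i) < 1)
    (hli : ∀ a : ι → K, P.1.valuationRing.valuation (∑ i, algebraMap K F (a i) * b i) < 1 →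
      ∀ i, a i = 0) : P.f = Fintype.card ι := by
  unfold Place.Over.f
  let := P.inclusion.toAlgebra
  have hlies : P.1.ideal.LiesOver (placeAtInfinity K).ideal := by
    refine ⟨?_⟩
    ext z
    rw [Ideal.mem_comap, Place.mem_ideal, Place.mem_ideal]
    exact (P.2.valuation_lt_one_iff z).symm
  rw [Ideal.inertiaDeg'_algebraMap]
  have : (placeAtInfinity K).ideal.IsMaximal := IsLocalRing.maximalIdeal.isMaximal _
  let := Ideal.Quotient.field (placeAtInfinity K).ideal
  let κ : K → (placeAtInfinity K).valuationRing := fun a ↦ ⟨_, (placeAtInfinity K).algebraMap_mem a⟩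
  have hκ : ∀ g : (placeAtInfinity K).valuationRing ⧸ (placeAtInfinity K).ideal,
      ∃ a : K, g = Ideal.Quotient.mk _ (κ a) := by
    intro g
    obtain ⟨z, rfl⟩ := Ideal.Quotient.mk_surjective g
    obtain ⟨_, ⟨a, rfl⟩, ha⟩ := (leadSystem K).exists_residue (led K) rfl
      ((ValuationSubring.valuation_le_one_iff _ _).2 z.2)
    exact ⟨a, Ideal.Quotient.eq.2 (Place.mem_ideal.2 ha)⟩
  let β : ι → P.1.valuationRing ⧸ P.1.ideal := fun i ↦ Ideal.Quotient.mk _ ⟨b i, hb i⟩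
  let κ' : K → P.1.valuationRing := fun a ↦ ⟨_, P.1.algebraMap_mem a⟩
  have hsum : ∀ a : ι → K, ∑ i, (Ideal.Quotient.mk (placeAtInfinity K).ideal (κ (a i))) • β i =
      Ideal.Quotient.mk P.1.ideal (∑ i, κ' (a i) * ⟨b i, hb i⟩) := by
    intro a
    rw [map_sum]
    refine Finset.sum_congr rfl fun i _ ↦ ?_
    rw [Algebra.smul_def, map_mul]
    congr 1
    change Ideal.Quotient.mk P.1.ideal (P.inclusion (κ (a i))) = _
    congr 1
    exact Subtype.ext (IsScalarTower.algebraMap_apply K (RatFunc K) F (a i)).symm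
  have hli' : LinearIndependent ((placeAtInfinity K).valuationRing ⧸ (placeAtInfinity K).ideal) β := by
    rw [Fintype.linearIndependent_iff]
    intro g hg
    choose a ha using fun i ↦ hκ (g i)
    simp only [ha] at hg ⊢
    rw [hsum, Ideal.Quotient.eq_zero_iff_mem, Place.mem_ideal] at hg
    push_cast at hg
    intro i
    rw [hli a hg i]
    simp [κ]
    rfl
  have hspan' : ⊤ ≤ Submodule.span
      ((placeAtInfinity K).valuationRing ⧸ (placeAtInfinity K).ideal) (Set.range β) := by
    rintro g -
    obtain ⟨z, rfl⟩ := Ideal.Quotient.mk_surjective g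
    obtain ⟨a, ha⟩ := hspan z z.2
    have : Ideal.Quotient.mk P.1.ideal z =
        ∑ i, (Ideal.Quotient.mk (placeAtInfinity K).ideal (κ (a i))) • β i := by
      rw [hsum, Ideal.Quotient.eq, Place.mem_ideal]
      push_cast
      exact ha
    rw [this]
    exact Submodule.sum_mem _ fun i _ ↦ Submodule.smul_mem _ _ (Submodule.subset_span ⟨i, rfl⟩)
  exact Module.finrank_eq_card_basis (Module.Basis.mk hli' hspan')

end placeAtInfinity

/-! ### Valuation rings of K(x, t) above a point of the x-line. -/

section RationalParameter

variable {K F : Type*} [Field K] [Field F] [Algebra K F]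

theorem ValuationSubring.valuation_aeval_le_one {O : ValuationSubring F}
    (hO : ∀ a : K, algebraMap K F a ∈ O) {z : F} (hz : z ∈ O) (p : K[X]) :
    O.valuation (aeval z p) ≤ 1 := by
  rw [O.valuation_le_one_iff, aeval_eq_sum_range]
  refine sum_mem fun i _ ↦ ?_
  rw [Algebra.smul_def]
  exact O.mul_mem _ _ (hO _) (pow_mem hz _)

theorem ValuationSubring.mem_of_valuation_sub_lt_one {O : ValuationSubring F} {z c : F}
    (hc : c ∈ O) (h : O.valuation (z - c) < 1) : z ∈ O := by
  rw [← sub_add_cancel z c]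
  exact O.add_mem _ _ ((O.valuation_le_one_iff _).1 h.le) hc

theorem ValuationSubring.valuation_eq_one_of_sub_lt_one {O : ValuationSubring F} {z c : F}
    (hc : O.valuation c = 1) (h : O.valuation (z - c) < 1) : O.valuation z = 1 := by
  have := O.valuation.map_add_eq_of_lt_right (x := z - c) (y := c) (by rwa [hc])
  rwa [sub_add_cancel, hc] at this

theorem ValuationSubring.valuation_aeval_sub_lt_one {O : ValuationSubring F}
    (hO : ∀ a : K, algebraMap K F a ∈ O) {z : F} {a : K}
    (hz : O.valuation (z - algebraMap K F a) < 1) (p : K[X]) :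
    O.valuation (aeval z p - algebraMap K F (p.eval a)) < 1 := by
  obtain ⟨q, hq⟩ := X_sub_C_dvd_sub_C_eval (a := a) (p := p)
  have h1 : aeval z p - algebraMap K F (p.eval a) = (z - algebraMap K F a) * aeval z q := by
    have := congrArg (aeval z) hq
    simpa using this
  rw [h1, map_mul]
  exact mul_lt_one_of_lt_of_le hz
    (ValuationSubring.valuation_aeval_le_one hO (mem_of_valuation_sub_lt_one (hO a) hz) q)

theorem ValuationSubring.valuation_aeval_eq_one {O : ValuationSubring F}
    (hO : ∀ a : K, algebraMap K F a ∈ O) {z : F} {a : K}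
    (hz : O.valuation (z - algebraMap K F a) < 1) {p : K[X]} (hp : p.eval a ≠ 0) :
    O.valuation (aeval z p) = 1 :=
  valuation_eq_one_of_sub_lt_one (valuation_algebraMap hO hp) (valuation_aeval_sub_lt_one hO hz p)

/-- The ideal generated by `z` in K[z] is proper, because 1 = z p(z) would make `z` algebraic. Some
valuation ring of `F` contains K[z] and has this ideal among its nonunits. -/
theorem exists_valuationSubring_of_transcendental {z : F} (hz : Transcendental K z) :
    ∃ O : ValuationSubring F, (∀ a : K, algebraMap K F a ∈ O) ∧ O.valuation z < 1 := by
  let A := (Algebra.adjoin K {z}).toSubring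
  let z' : A := ⟨z, Algebra.self_mem_adjoin_singleton K z⟩
  have hI : Ideal.span {z'} ≠ ⊤ := by
    intro h
    obtain ⟨⟨b, hb⟩, hab⟩ := Ideal.mem_span_singleton.1 ((Ideal.eq_top_iff_one _).1 h)
    obtain ⟨p, hp⟩ := (Algebra.adjoin_singleton_eq_range_aeval K z ▸ hb :
      b ∈ (aeval (R := K) z).range)
    have h1 : (1 : F) = z * b := congrArg Subtype.val hab
    have h2 : aeval z (X * p - 1 : K[X]) = 0 := by
      rw [map_sub, map_mul, aeval_X, map_one, h1, ← hp, sub_eq_zero]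
      rfl
    have h3 := (transcendental_iff.1 hz) _ h2
    have := congrArg (eval 0) h3
    simp at this
  obtain ⟨O, hAO, hO⟩ := Ideal.image_subset_nonunits_valuationSubring _ hI
  exact ⟨O, fun a ↦ hAO ((Algebra.adjoin K {z}).algebraMap_mem a),
    hO ⟨z', Ideal.mem_span_singleton_self _, rfl⟩⟩

/-- Reduce a polynomial in `t` modulo the monic T^n - t^n over K(x). The expression need not be
unique, so irreducibility plays no role. -/
theorem exists_sum_pow {x t : F} (hF : IntermediateField.adjoin K {x, t} = ⊤) {n : ℕ} (hn : 0 < n)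
    (ht : t ^ n ∈ IntermediateField.adjoin K {x}) (z : F) :
    ∃ a : ℕ → F, (∀ i, a i ∈ IntermediateField.adjoin K {x}) ∧
      z = ∑ i ∈ Finset.range n, a i * t ^ i := by
  set L := IntermediateField.adjoin K {x}
  have hmonic : (X ^ n - C (⟨t ^ n, ht⟩ : L)).Monic := monic_X_pow_sub_C _ hn.ne'
  have hroot : aeval t (X ^ n - C (⟨t ^ n, ht⟩ : L)) = 0 := by
    simp [IntermediateField.algebraMap_apply]
  have hz : z ∈ IntermediateField.adjoin L {t} := by
    have : z ∈ (IntermediateField.adjoin L {t}).restrictScalars K := by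
      rw [IntermediateField.adjoin_simple_adjoin_simple, hF]
      trivial
    exact this
  rw [← IntermediateField.mem_toSubalgebra, IntermediateField.adjoin_simple_toSubalgebra_of_isAlgebraic
    ⟨_, hmonic.ne_zero, hroot⟩, Algebra.adjoin_singleton_eq_range_aeval] at hz
  obtain ⟨p, hp⟩ := hz
  refine ⟨fun i ↦ ((p %ₘ (X ^ n - C (⟨t ^ n, ht⟩ : L))).coeff i : L), fun i ↦ Subtype.mem _, ?_⟩
  have h1 : aeval t (p %ₘ (X ^ n - C (⟨t ^ n, ht⟩ : L))) = z := by
    rw [← hp, aeval_modByMonic_eq_self_of_root hroot]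
    rfl
  have hdeg : (p %ₘ (X ^ n - C (⟨t ^ n, ht⟩ : L))).natDegree < n := by
    have := natDegree_modByMonic_lt p hmonic fun h ↦ by
      have := congrArg natDegree h
      rw [natDegree_X_pow_sub_C, natDegree_one] at this
      omega
    rwa [natDegree_X_pow_sub_C] at this
  rw [← h1, aeval_eq_sum_range' hdeg]
  exact Finset.sum_congr rfl fun i _ ↦ Algebra.smul_def _ _

theorem adjoin_sub_algebraMap_inv (x : F) (a : K) :
    IntermediateField.adjoin K {x} ≤ IntermediateField.adjoin K {(x - algebraMap K F a)⁻¹} := by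
  rw [IntermediateField.adjoin_simple_le_iff]
  have h := inv_mem (IntermediateField.mem_adjoin_simple_self K (x - algebraMap K F a)⁻¹)
  rw [inv_inv] at h
  have := add_mem h (IntermediateField.algebraMap_mem _ a)
  rwa [sub_add_cancel] at this

/-- The valuation rings at which `x` takes the value `a`. -/
def valuationRingsAt (x : F) (a : K) : Set (ValuationSubring F) :=
  {O | (∀ b : K, algebraMap K F b ∈ O) ∧ O.valuation (x - algebraMap K F a) < 1}

/-! ### Total ramification at a simple pole of t^n. -/

section TotallyRamified

variable {x t : F} {n : ℕ} {a : K} {A B : K[X]} (hn : 0 < n) (hA : A.eval a ≠ 0) (hB : B.eval a ≠ 0)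
  (hx : Transcendental K x)
  (hrel : t ^ n * ((x - algebraMap K F a) * aeval x B) = - aeval x A)
include hn hA hB hx hrel

omit hn hx in
theorem valuation_pow_eq_of_mem_valuationRingsAt {O : ValuationSubring F}
    (hO : O ∈ valuationRingsAt x a) :
    O.valuation t ^ n = (O.valuation (x - algebraMap K F a))⁻¹ := by
  have h := congrArg O.valuation hrel
  rw [Valuation.map_neg, map_mul, map_mul, map_pow,
    ValuationSubring.valuation_aeval_eq_one hO.1 hO.2 hA,
    ValuationSubring.valuation_aeval_eq_one hO.1 hO.2 hB, mul_one] at h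
  exact eq_inv_of_mul_eq_one_left h

theorem leadSystem_valuationRingsAt :
    LeadSystem (valuationRingsAt x a) (algebraMap K F).range.toAddSubgroup t := by
  have hxa : Transcendental K (x - algebraMap K F a) := fun h ↦ hx (by
    simpa using h.add (isAlgebraic_algebraMap a))
  refine LeadSystem.of_const (exists_valuationSubring_of_transcendental hxa) (fun O hO ↦ hO.1) ?_
  intro O hO
  rw [← one_lt_pow_iff_of_nonneg zero_le hn.ne',
    valuation_pow_eq_of_mem_valuationRingsAt hA hB hrel hO]
  have : x - algebraMap K F a ≠ 0 := by
    intro h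
    exact hxa (h ▸ isAlgebraic_zero)
  exact (one_lt_inv₀ (O.valuation.pos_iff.2 this)).2 hO.2

/-- The relation gives 1/(x-a) = -(B/A)(x) t^n, so this generator of K(x) has exponent `n` and
leading coefficient -B(a)/A(a). -/
theorem led_valuationRingsAt_of_mem_adjoin {z : F} (hz : z ∈ IntermediateField.adjoin K {x}) :
    Led (valuationRingsAt x a) (algebraMap K F).range.toAddSubgroup t ((n : ℤ) ∣ ·) z := by
  have h := leadSystem_valuationRingsAt hn hA hB hx hrel
  have hxa : x - algebraMap K F a ≠ 0 := by
    intro h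
    exact hx (sub_eq_zero.1 h ▸ isAlgebraic_algebraMap a)
  have ht : t ≠ 0 := h.ne_zero
  refine h.led_adjoin (fun a ↦ ⟨a, rfl⟩) (by exact_mod_cast hn.ne') ?_
    (adjoin_sub_algebraMap_inv x a hz)
  refine Or.inr ⟨n, algebraMap K F (-B.eval a / A.eval a), rfl, ⟨_, rfl⟩, by
    simpa using ⟨hB, hA⟩, fun O hO ↦ ?_⟩
  have hA1 := ValuationSubring.valuation_aeval_eq_one hO.1 hO.2 hA
  have hA0 : aeval x A ≠ 0 := by
    rw [← O.valuation.ne_zero_iff, hA1]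
    exact one_ne_zero
  have hA' : algebraMap K F (A.eval a) ≠ 0 := by simpa using hA
  have h1 : (x - algebraMap K F a)⁻¹ / t ^ (n : ℤ) - algebraMap K F (-B.eval a / A.eval a) =
      (aeval x (A * C (B.eval a) - B * C (A.eval a)) / algebraMap K F (A.eval a)) / aeval x A := by
    have h2 : (x - algebraMap K F a)⁻¹ / t ^ (n : ℤ) = - aeval x B / aeval x A := by
      rw [zpow_natCast]
      field_simp
      rw [neg_eq_iff_eq_neg.1 hrel.symm]
      ring
    rw [h2]
    simp only [map_div₀, map_neg, map_sub, map_mul, aeval_C]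
    field_simp
    ring
  rw [h1, map_div₀, map_div₀, hA1, ValuationSubring.valuation_algebraMap hO.1 hA, div_one, div_one]
  have h3 := ValuationSubring.valuation_aeval_sub_lt_one hO.1 hO.2
    (A * C (B.eval a) - B * C (A.eval a))
  -- The difference from the leading coefficient has a numerator that vanishes at x = a.
  have h4 : (A * C (B.eval a) - B * C (A.eval a)).eval a = 0 := by
    simp [mul_comm]
  simpa only [h4, map_zero, sub_zero] using h3

theorem led_valuationRingsAt (hF : IntermediateField.adjoin K {x, t} = ⊤)
    (ht : t ^ n ∈ IntermediateField.adjoin K {x}) (z : F) :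
    Led (valuationRingsAt x a) (algebraMap K F).range.toAddSubgroup t (fun _ ↦ True) z := by
  have h := leadSystem_valuationRingsAt hn hA hB hx hrel
  obtain ⟨c, hc, rfl⟩ := exists_sum_pow hF hn ht z
  exact h.led_sum_pow isCoprime_one_right
    (Or.inr ⟨1, 1, rfl, h.one_mem, one_ne_zero, h.hasLead_self⟩) c
    fun i ↦ led_valuationRingsAt_of_mem_adjoin hn hA hB hx hrel (hc i)

end TotallyRamified

end RationalParameter

/-! ### The function field of the curve, and its places at x = 0 and x = 1. -/

section Curve

variable {K F : Type*} [Field K] [Field F] [Algebra K F]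

/-- `F = K(x, t)` is the function field of the curve with the equation `rel`, where the
exponent `r + 1` is written as `2 * e + 4`. -/
structure IsCurve (K : Type*) {F : Type*} [Field K] [Field F] [Algebra K F] (x t : F) (e : ℕ) :
    Prop where
  two_ne : (2 : K) ≠ 0
  transcendental : Transcendental K x
  adjoin_eq_top : IntermediateField.adjoin K {x, t} = ⊤
  rel : t ^ (2 * e + 4) * (x * (x - 1)) =
    -(x ^ (2 * e + 4) + 2 * x ^ (e + 2) - x ^ 3 + x ^ 2 + 1)

/-- The numerator of `-t ^ (2 * e + 4)` as a rational function of `x`. -/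
noncomputable def curveNumerator (K : Type*) [Field K] (e : ℕ) : K[X] :=
  X ^ (2 * e + 4) + 2 * X ^ (e + 2) - X ^ 3 + X ^ 2 + 1

/-- The square of `curveW` as a polynomial in `x⁻¹`. -/
noncomputable def curveH (K : Type*) [Field K] (e : ℕ) : K[X] :=
  -(1 + 2 * X ^ (e + 2) - X ^ (2 * e + 1) + X ^ (2 * e + 2) + X ^ (2 * e + 4)) * (1 - X)

/-- An element that takes the values `±√-1` at the poles of `x`. -/
def curveW {F : Type*} [Field F] (x t : F) (e : ℕ) : F := t ^ (e + 2) * (x - 1) / x ^ (e + 2)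

namespace IsCurve

variable {x t : F} {e : ℕ} (h : IsCurve K x t e)
include h

theorem x_ne_zero : x ≠ 0 := by
  rintro rfl
  exact h.transcendental isAlgebraic_zero

theorem x_sub_one_ne_zero : x - 1 ≠ 0 := fun h1 ↦
  h.transcendental (sub_eq_zero.1 h1 ▸ isAlgebraic_one)

theorem rel_zero : t ^ (2 * e + 4) * ((x - algebraMap K F 0) * aeval x (X - 1 : K[X])) =
    - aeval x (curveNumerator K e) := by
  simpa [curveNumerator, map_ofNat] using h.rel

theorem rel_one : t ^ (2 * e + 4) * ((x - algebraMap K F 1) * aeval x (X : K[X])) =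
    - aeval x (curveNumerator K e) := by
  simpa [curveNumerator, map_ofNat, mul_comm (x - 1)] using h.rel

omit h in
theorem eval_curveNumerator_zero : (curveNumerator K e).eval 0 ≠ 0 := by
  simp [curveNumerator]

theorem eval_curveNumerator_one : (curveNumerator K e).eval 1 ≠ 0 := by
  have : (curveNumerator K e).eval 1 = 2 * 2 := by
    simp [curveNumerator]
    norm_num
  rw [this]
  exact mul_ne_zero h.two_ne h.two_ne

theorem pow_mem_adjoin : t ^ (2 * e + 4) ∈ IntermediateField.adjoin K {x} := by
  have hx := IntermediateField.mem_adjoin_simple_self K x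
  have h0 := mul_ne_zero h.x_ne_zero h.x_sub_one_ne_zero
  rw [eq_div_of_mul_eq h0 h.rel, IntermediateField.mem_adjoin_simple_iff]
  exact ⟨-curveNumerator K e, X * (X - 1), by simp [curveNumerator, map_ofNat]⟩

theorem leadSystem_zero :
    LeadSystem (valuationRingsAt x (0 : K)) (algebraMap K F).range.toAddSubgroup t :=
  leadSystem_valuationRingsAt (by positivity) eval_curveNumerator_zero (by simp) h.transcendental
    h.rel_zero

theorem led_zero (z : F) : Led (valuationRingsAt x (0 : K)) (algebraMap K F).range.toAddSubgroup t
    (fun _ ↦ True) z :=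
  led_valuationRingsAt (by positivity) eval_curveNumerator_zero (by simp) h.transcendental
    h.rel_zero h.adjoin_eq_top h.pow_mem_adjoin z

theorem leadSystem_one :
    LeadSystem (valuationRingsAt x (1 : K)) (algebraMap K F).range.toAddSubgroup t :=
  leadSystem_valuationRingsAt (by positivity) h.eval_curveNumerator_one (by simp) h.transcendental
    h.rel_one

theorem led_one (z : F) : Led (valuationRingsAt x (1 : K)) (algebraMap K F).range.toAddSubgroup t
    (fun _ ↦ True) z :=
  led_valuationRingsAt (by positivity) h.eval_curveNumerator_one (by simp) h.transcendental
    h.rel_one h.adjoin_eq_top h.pow_mem_adjoin z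

theorem t_ne_zero : t ≠ 0 := h.leadSystem_zero.ne_zero

/-- At x = 1 the exponent of `curveW` in t is -(e+2), whereas elements of K(x) have exponents
divisible by 2e+4. Thus 1 and `curveW` are independent over K(x), as needed in
`exists_valuationSubring_curveW`. -/
theorem curveW_notMem : curveW x t e ∉ IntermediateField.adjoin K {x} := by
  intro hw
  have hS := h.leadSystem_one
  obtain ⟨O, hO⟩ := hS.nonempty
  have hxO : O.valuation x = 1 :=
    ValuationSubring.valuation_eq_one_of_sub_lt_one (by simp) hO.2
  have h1 : O.valuation (x - 1) = (O.valuation t ^ (2 * e + 4))⁻¹ := by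
    rw [valuation_pow_eq_of_mem_valuationRingsAt h.eval_curveNumerator_one (by simp) h.rel_one hO,
      inv_inv, map_one]
  have ht0 : O.valuation t ≠ 0 := O.valuation.ne_zero_iff.2 h.t_ne_zero
  have h2 : O.valuation (curveW x t e) = O.valuation t ^ (-((e : ℤ) + 2)) := by
    rw [curveW, map_div₀, map_mul, map_pow, map_pow, hxO, one_pow, div_one, h1,
      ← zpow_natCast, ← zpow_natCast, ← zpow_neg, ← zpow_add₀ ht0]
    congr 1
    push_cast
    ring
  have h3 := led_valuationRingsAt_of_mem_adjoin (by positivity) h.eval_curveNumerator_one (by simp)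
    h.transcendental h.rel_one hw
  obtain h0 | ⟨k, c, ⟨j, rfl⟩, hc, hc0, hz⟩ := h3
  · rw [h0, map_zero] at h2
    exact zpow_ne_zero _ ht0 h2.symm
  · rw [hS.valuation_of_hasLead hc hc0 hz hO] at h2
    have := zpow_right_injective₀ (zero_lt_iff.2 ht0) (hS.one_lt O hO).ne' h2
    push_cast at this
    have : ((e : ℤ) + 2) * (2 * j + 1) = 0 := by linarith
    rcases mul_eq_zero.1 this with h | h <;> omega

theorem curveW_sq : curveW x t e ^ 2 = aeval x⁻¹ (curveH K e) := by
  have hx := h.x_ne_zero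
  have h0 := h.x_sub_one_ne_zero
  have h1 : t ^ (2 * e + 4) = _ := eq_div_of_mul_eq (mul_ne_zero hx h0) h.rel
  have h2 : curveW x t e ^ 2 = t ^ (2 * e + 4) * (x - 1) ^ 2 / x ^ (2 * e + 4) := by
    rw [curveW]; ring
  rw [h2, h1]
  simp only [curveH, map_mul, map_neg, map_sub, map_add, map_pow, map_one, aeval_X, map_ofNat,
    inv_pow]
  field_simp
  ring

/-! ### The poles of `x` -/

theorem transcendental_inv : Transcendental K x⁻¹ := fun h1 ↦
  h.transcendental (inv_inv x ▸ h1.inv)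

variable {O : ValuationSubring F} (hO : O ∈ valuationRingsAt x⁻¹ (0 : K))
include hO

theorem one_lt_valuation_x : 1 < O.valuation x := by
  rw [Valuation.one_lt_val_iff _ h.x_ne_zero]
  simpa using hO.2

theorem valuation_curveW_sq_add_one_lt_one : O.valuation (curveW x t e ^ 2 + 1) < 1 := by
  have := ValuationSubring.valuation_aeval_sub_lt_one hO.1 hO.2 (curveH K e)
  have h1 : (curveH K e).eval 0 = -1 := by simp [curveH]
  rw [h1, ← h.curveW_sq] at this
  simpa using this

theorem valuation_curveW : O.valuation (curveW x t e) = 1 := by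
  have h1 := h.valuation_curveW_sq_add_one_lt_one hO
  have h2 : O.valuation (curveW x t e ^ 2) = 1 :=
    ValuationSubring.valuation_eq_one_of_sub_lt_one (c := -1) (by simp) (by simpa using h1)
  rw [map_pow] at h2
  exact (pow_eq_one_iff_of_nonneg zero_le two_ne_zero).1 h2

theorem valuation_x_sub_one : O.valuation (x - 1) = O.valuation x :=
  O.valuation.map_sub_eq_of_lt_left (by rw [map_one]; exact h.one_lt_valuation_x hO)

omit hO in
-- As `curveW` is a unit at the poles of `x`, this exhibits x - 1 as an (e+2)-th power of x/t up to
-- a unit.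
theorem pow_mul_curveW : (x / t) ^ (e + 2) * curveW x t e = x - 1 := by
  have := h.x_ne_zero
  have := h.t_ne_zero
  rw [curveW, div_pow]
  field_simp

theorem valuation_div_pow : O.valuation (x / t) ^ (e + 2) = O.valuation x := by
  rw [← h.valuation_x_sub_one hO, ← h.pow_mul_curveW, map_mul, map_pow, h.valuation_curveW hO,
    mul_one]

theorem one_lt_valuation_div : 1 < O.valuation (x / t) := by
  rw [← one_lt_pow_iff_of_nonneg zero_le (show e + 2 ≠ 0 by omega), h.valuation_div_pow hO]
  exact h.one_lt_valuation_x hO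

theorem valuation_t : O.valuation t = O.valuation (x / t) ^ (e + 1) := by
  have h1 := h.valuation_div_pow hO
  have h2 : O.valuation (x / t) ≠ 0 := (zero_lt_one.trans (h.one_lt_valuation_div hO)).ne'
  have h3 : O.valuation x = O.valuation (x / t) * O.valuation t := by
    rw [← map_mul, div_mul_cancel₀ _ h.t_ne_zero]
  rw [h3, pow_succ', mul_right_inj' h2] at h1
  exact h1.symm

omit hO

/-- Since t^(e+2) lies in K(x) w, every element is a sum of a_i t^i with i < e+2 and a_i in K(x) +
K(x) w. In the parameter x/t the a_i have exponents divisible by e+2, because x - 1 has exponent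
e+2, while t has exponent e+1. So it suffices to know leading terms on K(x) + K(x) w. -/
theorem led_infinity {S : Set (ValuationSubring F)} {C : AddSubgroup F}
    (hS : S ⊆ valuationRingsAt x⁻¹ (0 : K)) (hC : LeadSystem S C (x / t)) {c : F} (hc : c ∈ C)
    (hc0 : c ≠ 0) (hw : ∀ O ∈ S, O.valuation (curveW x t e - c) < 1)
    (hE : ∀ a ∈ IntermediateField.adjoin K {x}, ∀ b ∈ IntermediateField.adjoin K {x},
      Led S C (x - 1) (fun _ ↦ True) (a + b * curveW x t e)) (z : F) :
    Led S C (x / t) (fun _ ↦ True) z := by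
  have hx0 := h.x_ne_zero
  have hx1 := h.x_sub_one_ne_zero
  have ht0 := h.t_ne_zero
  have hxmem := IntermediateField.mem_adjoin_simple_self K x
  have hu : x / t ≠ 0 := div_ne_zero hx0 ht0
  have hy : Led S C (x / t) (· = ((e + 2 : ℕ) : ℤ)) (x - 1) := by
    refine Or.inr ⟨_, c, rfl, hc, hc0, fun O hO ↦ ?_⟩
    rw [← h.pow_mul_curveW, zpow_natCast, mul_div_cancel_left₀ _ (pow_ne_zero _ hu)]
    exact hw O hO
  have hE' : ∀ a ∈ IntermediateField.adjoin K {x}, ∀ b ∈ IntermediateField.adjoin K {x},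
      Led S C (x / t) (((e + 2 : ℕ) : ℤ) ∣ ·) (a + b * curveW x t e) := by
    intro a ha b hb
    obtain h0 | ⟨k, c', -, hc', hc0', hz⟩ := hE a ha b hb
    · exact Or.inl h0
    · exact hC.led_of_hasLead hy hx1 hc' hc0' hz
  have ht : Led S C (x / t) (· = (e : ℤ) + 1) t := by
    refine Or.inr ⟨_, c, rfl, hc, hc0, fun O hO ↦ ?_⟩
    have h1 : t / (x / t) ^ ((e : ℤ) + 1) = x / (x - 1) * curveW x t e := by
      have h2 : (x / t) ^ ((e : ℤ) + 1) = (x / t) ^ (e + 1) := by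
        rw [← zpow_natCast]; push_cast; rfl
      have h3 : t * (x / t) = x := by field_simp
      have h4 := h.pow_mul_curveW
      rw [h2, div_eq_iff (pow_ne_zero _ hu), div_mul_eq_mul_div, div_mul_eq_mul_div,
        eq_div_iff hx1, ← h4,
        show t * ((x / t) ^ (e + 2) * curveW x t e) =
          t * (x / t) * curveW x t e * (x / t) ^ (e + 1) by ring, h3]
    have h2 : t / (x / t) ^ ((e : ℤ) + 1) - c =
        (curveW x t e - c) + curveW x t e / (x - 1) := by
      rw [h1]; field_simp; ring
    rw [h2]
    refine O.valuation.map_add_lt (hw O hO) ?_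
    rw [map_div₀, h.valuation_curveW (hS hO), h.valuation_x_sub_one (hS hO), one_div]
    exact inv_lt_one_of_one_lt₀ (h.one_lt_valuation_x (hS hO))
  obtain ⟨a, ha, rfl⟩ := exists_sum_pow h.adjoin_eq_top (by positivity) h.pow_mem_adjoin z
  -- The terms of index i and e+2+i are paired through t^(e+2) = w x^(e+2)/(x-1).
  have hsum : ∑ i ∈ Finset.range (2 * e + 4), a i * t ^ i = ∑ i ∈ Finset.range (e + 2),
      (a i + a (e + 2 + i) * (x ^ (e + 2) / (x - 1)) * curveW x t e) * t ^ i := by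
    rw [show 2 * e + 4 = (e + 2) + (e + 2) by ring, Finset.sum_range_add, ← Finset.sum_add_distrib]
    refine Finset.sum_congr rfl fun i _ ↦ ?_
    rw [curveW]
    field_simp
    ring
  rw [hsum]
  -- Coprimality: (e+2) - (e+1) = 1.
  refine hC.led_sum_pow ⟨1, -1, by push_cast; ring⟩ ht _ fun i ↦ hE' _ (ha i) _ ?_
  exact mul_mem (ha _) (div_mem (pow_mem hxmem _) (sub_mem hxmem (one_mem _)))

end IsCurve

end Curve

/-! ### Leading terms at the poles of x, with and without a square root of -1. -/

section Infinity

variable {K F : Type*} [Field K] [Field F] [Algebra K F]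

namespace IsCurve

variable {x t : F} {e : ℕ} (h : IsCurve K x t e)
include h

theorem led_of_mem_adjoin {S : Set (ValuationSubring F)} (hS : S.Nonempty)
    (hS' : S ⊆ valuationRingsAt x⁻¹ (0 : K)) {a : F} (ha : a ∈ IntermediateField.adjoin K {x}) :
    Led S (algebraMap K F).range.toAddSubgroup (x - 1) (fun _ ↦ True) a := by
  have hC : LeadSystem S (algebraMap K F).range.toAddSubgroup (x - 1) :=
    LeadSystem.of_const hS (fun O hO ↦ (hS' hO).1) fun O hO ↦ by
      rw [h.valuation_x_sub_one (hS' hO)]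
      exact h.one_lt_valuation_x (hS' hO)
  have hx : x ∈ IntermediateField.adjoin K {x - 1} := by
    have := add_mem (IntermediateField.mem_adjoin_simple_self K (x - 1)) (one_mem _)
    rwa [sub_add_cancel] at this
  exact LeadSystem.led_mono (fun _ _ ↦ trivial) (hC.led_adjoin (fun a ↦ ⟨a, rfl⟩) one_ne_zero
    (Or.inr ⟨1, 1, rfl, hC.one_mem, one_ne_zero, hC.hasLead_self⟩)
    (IntermediateField.adjoin_simple_le_iff.2 hx ha))

/-! ### Case of a square root of `-1` -/

/-- The ring K[1/x, w] is free over K[1/x] on 1 and w, with w² = H(1/x) and H(0) = -1. Hence (1/x, w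
- i) is a proper ideal with quotient K, and some valuation ring dominates it. -/
theorem exists_valuationSubring_curveW {i : K} (hi : i ^ 2 = -1) :
    ∃ O ∈ valuationRingsAt x⁻¹ (0 : K),
      O.valuation (curveW x t e - algebraMap K F i) < 1 := by
  set w := curveW x t e with hw
  let A := (Algebra.adjoin K {x⁻¹, w}).toSubring
  have hxA : x⁻¹ ∈ A := Algebra.subset_adjoin (by simp)
  have hwA : w ∈ A := Algebra.subset_adjoin (by simp)
  have hKA : ∀ a : K, algebraMap K F a ∈ A := (Algebra.adjoin K {x⁻¹, w}).algebraMap_mem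
  let x' : A := ⟨x⁻¹, hxA⟩
  let w' : A := ⟨w - algebraMap K F i, sub_mem hwA (hKA i)⟩
  have hrep : ∀ z ∈ A, ∃ p q : K[X], z = aeval x⁻¹ p + aeval x⁻¹ q * w := by
    intro z hz
    induction hz using Algebra.adjoin_induction with
    | mem z hz =>
      rcases hz with rfl | rfl
      · exact ⟨X, 0, by simp⟩
      · exact ⟨0, 1, by simp⟩
    | algebraMap a => exact ⟨C a, 0, by simp⟩
    | add y z _ _ hy hz =>
      obtain ⟨p, q, rfl⟩ := hy
      obtain ⟨p', q', rfl⟩ := hz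
      exact ⟨p + p', q + q', by simp only [map_add]; ring⟩
    | mul y z _ _ hy hz =>
      obtain ⟨p, q, rfl⟩ := hy
      obtain ⟨p', q', rfl⟩ := hz
      refine ⟨p * p' + q * q' * curveH K e, p * q' + q * p', ?_⟩
      simp only [map_add, map_mul, ← h.curveW_sq, ← hw]
      ring
  have hind : ∀ p q : K[X], aeval x⁻¹ p + aeval x⁻¹ q * w = 0 → p = 0 ∧ q = 0 := by
    intro p q hpq
    have htr := transcendental_iff.1 h.transcendental_inv
    by_cases hq : q = 0
    · subst hq
      exact ⟨htr p (by simpa using hpq), rfl⟩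
    · exfalso
      have hq0 : aeval x⁻¹ q ≠ 0 := fun h0 ↦ hq (htr q h0)
      refine h.curveW_notMem ?_
      have h1 : w = aeval x⁻¹ (-p) / aeval x⁻¹ q := by
        rw [eq_div_iff hq0, map_neg]
        linear_combination hpq
      have h2 : w ∈ IntermediateField.adjoin K {x⁻¹} :=
        (IntermediateField.mem_adjoin_simple_iff K w).2 ⟨-p, q, h1⟩
      have h3 : x⁻¹ ∈ IntermediateField.adjoin K {x} :=
        inv_mem (IntermediateField.mem_adjoin_simple_self K x)
      exact IntermediateField.adjoin_simple_le_iff.2 h3 h2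
  have hI : Ideal.span {x', w'} ≠ ⊤ := by
    intro htop
    obtain ⟨⟨a, ha⟩, ⟨b, hb⟩, hab⟩ :=
      Ideal.mem_span_pair.1 ((Ideal.eq_top_iff_one _).1 htop)
    obtain ⟨p, q, rfl⟩ := hrep a ha
    obtain ⟨p', q', rfl⟩ := hrep b hb
    have h1 := congrArg Subtype.val hab
    change (aeval x⁻¹ p + aeval x⁻¹ q * w) * x⁻¹ +
      (aeval x⁻¹ p' + aeval x⁻¹ q' * w) * (w - algebraMap K F i) = 1 at h1
    have h2 := hind (p * X - p' * C i + q' * curveH K e - 1) (q * X + p' - q' * C i) (by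
      simp only [map_add, map_mul, map_sub, map_one, aeval_X, aeval_C, ← h.curveW_sq, ← hw]
      linear_combination h1)
    have h3 := congrArg (eval 0) h2.1
    have h4 := congrArg (eval 0) h2.2
    have h5 : (curveH K e).eval 0 = -1 := by simp [curveH]
    simp [h5] at h3 h4
    -- The coefficient of w gives p'(0) = q'(0) i, and then the constant coefficient reads -1 = 0.
    have h6 : (1 : K) = 0 := by linear_combination -h3 - i * h4 - eval 0 q' * hi
    exact one_ne_zero h6
  obtain ⟨O, hAO, hO⟩ := Ideal.image_subset_nonunits_valuationSubring _ hI
  refine ⟨O, ⟨fun a ↦ hAO (hKA a), ?_⟩, hO ⟨w', Ideal.subset_span (by simp), rfl⟩⟩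
  rw [map_zero, sub_zero]
  exact hO ⟨x', Ideal.subset_span (by simp), rfl⟩

/-- The poles of `x` at which `curveW` takes the value `i`. -/
def _root_.splitPoles (x t : F) (e : ℕ) (i : K) : Set (ValuationSubring F) :=
  {O | O ∈ valuationRingsAt x⁻¹ (0 : K) ∧ O.valuation (curveW x t e - algebraMap K F i) < 1}

theorem leadSystem_split {i : K} (hi : i ^ 2 = -1) :
    LeadSystem (splitPoles x t e i) (algebraMap K F).range.toAddSubgroup (x / t) :=
  LeadSystem.of_const (h.exists_valuationSubring_curveW hi) (fun _ hO ↦ hO.1.1)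
    fun _ hO ↦ h.one_lt_valuation_div hO.1

/-- On a + b w the leading coefficients α and β i may cancel when a and b have the same exponent.
Then the conjugate a - b w has leading coefficient 2α ≠ 0, and a + b w is the norm a² - b² w², an
element of K(x), divided by this conjugate. -/
theorem led_split {i : K} (hi : i ^ 2 = -1) (z : F) :
    Led (splitPoles x t e i) (algebraMap K F).range.toAddSubgroup (x / t) (fun _ ↦ True) z := by
  have hS : splitPoles x t e i ⊆ valuationRingsAt x⁻¹ (0 : K) := fun _ hO ↦ hO.1
  have hne : (splitPoles x t e i).Nonempty := h.exists_valuationSubring_curveW hi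
  have hi0 : i ≠ 0 := by rintro rfl; simp at hi
  have hC : LeadSystem (splitPoles x t e i) (algebraMap K F).range.toAddSubgroup (x - 1) :=
    LeadSystem.of_const hne (fun _ hO ↦ hO.1.1) fun O hO ↦ by
      rw [h.valuation_x_sub_one hO.1]
      exact h.one_lt_valuation_x hO.1
  refine h.led_infinity hS (h.leadSystem_split hi) (c := algebraMap K F i) ⟨i, rfl⟩
    (by simpa using hi0) (fun O hO ↦ hO.2) ?_ z
  intro a ha b hb
  have hbw : ∀ {k : ℤ} {c : F}, HasLead (splitPoles x t e i) (x - 1) b k c →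
      c ∈ (algebraMap K F).range.toAddSubgroup →
      HasLead (splitPoles x t e i) (x - 1) (b * curveW x t e) k (c * algebraMap K F i) := by
    intro k c hb hc O hO
    rw [mul_div_right_comm]
    exact ValuationSubring.valuation_mul_sub_lt_one (h.valuation_curveW hO.1).le
      (hC.le_one O hO c hc) (hb O hO) hO.2 (by simp)
  have hneg : ∀ {z c : F} {k : ℤ}, HasLead (splitPoles x t e i) (x - 1) z k c →
      HasLead (splitPoles x t e i) (x - 1) (-z) k (-c) := by
    intro z c k hz O hO
    rw [neg_div, ← neg_sub', Valuation.map_neg]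
    exact hz O hO
  obtain rfl | ⟨k, c, -, ⟨α, rfl⟩, hc0, hak⟩ := h.led_of_mem_adjoin hne hS ha
  · obtain rfl | ⟨l, _, -, ⟨β, rfl⟩, hc0', hbl⟩ := h.led_of_mem_adjoin hne hS hb
    · exact Or.inl (by simp)
    · exact Or.inr ⟨l, algebraMap K F β * algebraMap K F i, trivial, ⟨β * i, by simp⟩, mul_ne_zero hc0' (by simpa using hi0),
        by simpa using hbw hbl ⟨β, rfl⟩⟩
  obtain rfl | ⟨l, _, -, ⟨β, rfl⟩, hc0', hbl⟩ := h.led_of_mem_adjoin hne hS hb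
  · exact Or.inr ⟨k, _, trivial, ⟨α, rfl⟩, hc0, by simpa using hak⟩
  have hbl' := hbw hbl ⟨β, rfl⟩
  have hβi : algebraMap K F β * algebraMap K F i ∈ (algebraMap K F).range.toAddSubgroup :=
    ⟨β * i, by simp⟩
  have hβi0 : algebraMap K F β * algebraMap K F i ≠ 0 := mul_ne_zero hc0' (by simpa using hi0)
  rcases lt_trichotomy k l with hkl | rfl | hkl
  · refine Or.inr ⟨l, _, trivial, hβi, hβi0, ?_⟩
    rw [add_comm]
    exact hC.hasLead_add_of_lt ⟨α, rfl⟩ hc0 hbl' hak hkl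
  · by_cases hsum : algebraMap K F α + algebraMap K F β * algebraMap K F i = 0
    · have hconj := LeadSystem.hasLead_add hak (hneg hbl')
      have hc1 : algebraMap K F α + -(algebraMap K F β * algebraMap K F i) ≠ 0 := by
        rw [← eq_neg_iff_add_eq_zero.2 hsum, ← two_mul]
        refine mul_ne_zero ?_ hc0
        rw [← map_ofNat (algebraMap K F) 2]
        simpa using h.two_ne
      have hconj' : Led (splitPoles x t e i) (algebraMap K F).range.toAddSubgroup (x - 1)
          (fun _ ↦ True) (a + -(b * curveW x t e)) :=
        Or.inr ⟨k, _, trivial, ⟨α + -(β * i), by simp⟩, hc1, hconj⟩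
      have hconj0 : a + -(b * curveW x t e) ≠ 0 := by
        intro h0
        obtain ⟨O, hO⟩ := hne
        have := hC.valuation_of_hasLead ⟨α + -(β * i), by simp⟩ hc1 hconj hO
        rw [h0, map_zero] at this
        exact zpow_ne_zero _ (O.valuation.ne_zero_iff.2 h.x_sub_one_ne_zero) this.symm
      have hN : a ^ 2 - b ^ 2 * curveW x t e ^ 2 ∈ IntermediateField.adjoin K {x} := by
        refine sub_mem (pow_mem ha 2) (mul_mem (pow_mem hb 2) ?_)
        have h1 : curveW x t e ^ 2 ∈ IntermediateField.adjoin K {x⁻¹} :=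
          (IntermediateField.mem_adjoin_simple_iff K _).2
            ⟨curveH K e, 1, by rw [h.curveW_sq]; simp⟩
        have h3 : x⁻¹ ∈ IntermediateField.adjoin K {x} :=
          inv_mem (IntermediateField.mem_adjoin_simple_self K x)
        exact IntermediateField.adjoin_simple_le_iff.2 h3 h1
      have heq : a + b * curveW x t e =
          (a ^ 2 - b ^ 2 * curveW x t e ^ 2) * (a + -(b * curveW x t e))⁻¹ := by
        rw [eq_mul_inv_iff_mul_eq₀ hconj0]
        ring
      rw [heq]
      exact hC.led_mul (fun _ _ _ _ ↦ trivial) (h.led_of_mem_adjoin hne hS hN)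
        (hC.led_inv (R' := fun _ ↦ True) (fun _ _ ↦ trivial) hconj')
    · exact Or.inr ⟨k, _, trivial, ⟨α + β * i, by simp⟩, hsum, LeadSystem.hasLead_add hak hbl'⟩
  · exact Or.inr ⟨k, _, trivial, ⟨α, rfl⟩, hc0, hC.hasLead_add_of_lt hβi hβi0 hak hbl' hkl⟩

/-! ### Case of no square root of `-1` -/

/-- The `K`-linear combinations of `1` and `w`. -/
def _root_.constAddMul (K : Type*) {F : Type*} [Field K] [Field F] [Algebra K F] (w : F) :
    AddSubgroup F :=
  (Submodule.span K {1, w}).toAddSubgroup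

omit h in
theorem mem_constAddMul {w z : F} :
    z ∈ constAddMul K w ↔ ∃ a b : K, algebraMap K F a + algebraMap K F b * w = z := by
  rw [constAddMul, Submodule.mem_toAddSubgroup, Submodule.mem_span_pair]
  simp only [Algebra.smul_def, mul_one]

omit h in
theorem sq_add_sq_ne_zero (hsq : ¬ IsSquare (-1 : K)) {a b : K} (hab : a ≠ 0 ∨ b ≠ 0) :
    a ^ 2 + b ^ 2 ≠ 0 := by
  intro h0
  by_cases hb : b = 0
  · subst hb
    simp_all
  · exact hsq ⟨a / b, by field_simp; linear_combination -h0⟩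

/-- Because w² ≡ -1, the space K + K w represents the field K(√-1), with inverse (a - b w)/(a² +
b²). It is multiplicatively closed only modulo smaller terms, hence the congruences in `LeadSystem`.
-/
theorem leadSystem_nonsplit (hsq : ¬ IsSquare (-1 : K)) {u : F}
    (hu : ∀ O ∈ valuationRingsAt x⁻¹ (0 : K), 1 < O.valuation u) :
    LeadSystem (valuationRingsAt x⁻¹ (0 : K)) (constAddMul K (curveW x t e)) u where
  nonempty := by
    obtain ⟨O, hO, hO'⟩ := exists_valuationSubring_of_transcendental h.transcendental_inv
    exact ⟨O, hO, by simpa using hO'⟩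
  one_lt := hu
  le_one := by
    intro O hO c hc
    obtain ⟨a, b, rfl⟩ := mem_constAddMul.1 hc
    have ha := (O.valuation_le_one_iff _).2 (hO.1 a)
    have hb := (O.valuation_le_one_iff _).2 (hO.1 b)
    refine O.valuation.map_add_le ha ?_
    rw [map_mul, h.valuation_curveW hO, mul_one]
    exact hb
  one_mem := mem_constAddMul.2 ⟨1, 0, by simp⟩
  mul := by
    intro c hc c' hc'
    obtain ⟨a, b, rfl⟩ := mem_constAddMul.1 hc
    obtain ⟨a', b', rfl⟩ := mem_constAddMul.1 hc'
    refine ⟨_, mem_constAddMul.2 ⟨a * a' - b * b', a * b' + b * a', rfl⟩, fun O hO ↦ ?_⟩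
    have h1 := h.valuation_curveW_sq_add_one_lt_one hO
    have h2 := (O.valuation_le_one_iff _).2 (hO.1 (b * b'))
    have h3 : (algebraMap K F a + algebraMap K F b * curveW x t e) *
        (algebraMap K F a' + algebraMap K F b' * curveW x t e) -
        (algebraMap K F (a * a' - b * b') + algebraMap K F (a * b' + b * a') * curveW x t e) =
        (curveW x t e ^ 2 + 1) * algebraMap K F (b * b') := by
      simp only [map_sub, map_add, map_mul]
      ring
    rw [h3, map_mul]
    exact mul_lt_one_of_lt_of_le h1 h2
  inv := by
    intro c hc hc0
    obtain ⟨a, b, rfl⟩ := mem_constAddMul.1 hc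
    have hab : a ≠ 0 ∨ b ≠ 0 := by
      by_contra! hab
      simp [hab.1, hab.2] at hc0
    have hN := sq_add_sq_ne_zero hsq hab
    refine ⟨_, mem_constAddMul.2 ⟨a / (a ^ 2 + b ^ 2), -b / (a ^ 2 + b ^ 2), rfl⟩,
      fun O hO ↦ ?_⟩
    have h1 := h.valuation_curveW_sq_add_one_lt_one hO
    have h2 := (O.valuation_le_one_iff _).2 (hO.1 (-b ^ 2 / (a ^ 2 + b ^ 2)))
    have hN' : algebraMap K F a ^ 2 + algebraMap K F b ^ 2 ≠ 0 := by
      rw [← map_pow, ← map_pow, ← map_add]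
      exact (_root_.map_ne_zero _).2 hN
    have h3 : (algebraMap K F a + algebraMap K F b * curveW x t e) *
        (algebraMap K F (a / (a ^ 2 + b ^ 2)) +
          algebraMap K F (-b / (a ^ 2 + b ^ 2)) * curveW x t e) - 1 =
        (curveW x t e ^ 2 + 1) * algebraMap K F (-b ^ 2 / (a ^ 2 + b ^ 2)) := by
      simp only [map_div₀, map_neg, map_add, map_pow]
      field_simp
      ring
    rw [h3, map_mul]
    exact mul_lt_one_of_lt_of_le h1 h2

theorem valuation_add_mul_curveW (hsq : ¬ IsSquare (-1 : K)) {O : ValuationSubring F}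
    (hO : O ∈ valuationRingsAt x⁻¹ (0 : K)) {a b : K} (hab : a ≠ 0 ∨ b ≠ 0) :
    O.valuation (algebraMap K F a + algebraMap K F b * curveW x t e) = 1 := by
  have hC := h.leadSystem_nonsplit hsq (u := x / t) fun O hO ↦ h.one_lt_valuation_div hO
  refine hC.valuation_eq_one (mem_constAddMul.2 ⟨a, b, rfl⟩) ?_ hO
  intro h0
  have h1 := h.valuation_curveW_sq_add_one_lt_one hO
  -- If a + b w = 0, the nonzero constant a² + b² equals b²(w² + 1), which has value less than 1.
  have h2 : algebraMap K F (a ^ 2 + b ^ 2) =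
      algebraMap K F (b ^ 2) * (curveW x t e ^ 2 + 1) := by
    simp only [map_add, map_pow]
    linear_combination (algebraMap K F a - algebraMap K F b * curveW x t e) * h0
  have h3 := ValuationSubring.valuation_algebraMap hO.1 (sq_add_sq_ne_zero hsq hab)
  rw [h2, map_mul, mul_comm] at h3
  exact (mul_lt_one_of_lt_of_le h1 ((O.valuation_le_one_iff _).2 (hO.1 _))).ne h3

theorem add_mul_curveW_ne_zero (hsq : ¬ IsSquare (-1 : K)) {a b : K} (hab : a ≠ 0 ∨ b ≠ 0) :
    algebraMap K F a + algebraMap K F b * curveW x t e ≠ 0 := by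
  obtain ⟨O, hO, hO'⟩ := exists_valuationSubring_of_transcendental h.transcendental_inv
  have := h.valuation_add_mul_curveW hsq (O := O) ⟨hO, by simpa using hO'⟩ hab
  intro h0
  rw [h0, map_zero] at this
  exact zero_ne_one this

/-- Here no conjugate is needed: α + β w is a nonzero element of the coefficient space unless α = β
= 0, so no cancellation occurs. -/
theorem led_nonsplit (hsq : ¬ IsSquare (-1 : K)) (z : F) :
    Led (valuationRingsAt x⁻¹ (0 : K)) (constAddMul K (curveW x t e)) (x / t) (fun _ ↦ True) z := by
  have hC := h.leadSystem_nonsplit hsq (u := x - 1) fun O hO ↦ by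
    rw [h.valuation_x_sub_one hO]
    exact h.one_lt_valuation_x hO
  refine h.led_infinity subset_rfl
    (h.leadSystem_nonsplit hsq fun O hO ↦ h.one_lt_valuation_div hO) (c := curveW x t e)
    (mem_constAddMul.2 ⟨0, 1, by simp⟩)
    (by simpa using h.add_mul_curveW_ne_zero hsq (a := 0) (b := 1) (by simp)) (by simp) ?_ z
  intro a ha b hb
  have hbw : ∀ {k : ℤ} {c : F}, HasLead (valuationRingsAt x⁻¹ (0 : K)) (x - 1) b k c →
      HasLead (valuationRingsAt x⁻¹ (0 : K)) (x - 1) (b * curveW x t e) k (c * curveW x t e) := by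
    intro k c hb O hO
    rw [mul_div_right_comm, ← sub_mul, map_mul, h.valuation_curveW hO, mul_one]
    exact hb O hO
  have hmem : ∀ a b : K, algebraMap K F a + algebraMap K F b * curveW x t e ∈
      constAddMul K (curveW x t e) := fun a b ↦ mem_constAddMul.2 ⟨a, b, rfl⟩
  have hmem1 : ∀ a : K, algebraMap K F a ∈ constAddMul K (curveW x t e) :=
    fun a ↦ by simpa using hmem a 0
  have hmem2 : ∀ a : K, algebraMap K F a * curveW x t e ∈ constAddMul K (curveW x t e) :=
    fun a ↦ by simpa using hmem 0 a
  have hne2 : ∀ {a : K}, algebraMap K F a ≠ 0 → algebraMap K F a * curveW x t e ≠ 0 := by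
    intro a ha
    have ha0 : a ≠ 0 := by simpa using ha
    simpa using h.add_mul_curveW_ne_zero hsq (a := 0) (b := a) (Or.inr ha0)
  obtain rfl | ⟨k, _, -, ⟨α, rfl⟩, hc0, hak⟩ := h.led_of_mem_adjoin hC.nonempty subset_rfl ha
  · obtain rfl | ⟨l, _, -, ⟨β, rfl⟩, hc0', hbl⟩ := h.led_of_mem_adjoin hC.nonempty subset_rfl hb
    · exact Or.inl (by simp)
    · exact Or.inr ⟨l, _, trivial, hmem2 β, hne2 hc0', by simpa using hbw hbl⟩
  obtain rfl | ⟨l, _, -, ⟨β, rfl⟩, hc0', hbl⟩ := h.led_of_mem_adjoin hC.nonempty subset_rfl hb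
  · exact Or.inr ⟨k, _, trivial, hmem1 α, hc0, by simpa using hak⟩
  rcases lt_trichotomy k l with hkl | rfl | hkl
  · refine Or.inr ⟨l, _, trivial, hmem2 β, hne2 hc0', ?_⟩
    rw [add_comm]
    exact hC.hasLead_add_of_lt (hmem1 α) hc0 (hbw hbl) hak hkl
  · have hα0 : α ≠ 0 := by simpa using hc0
    exact Or.inr ⟨k, _, trivial, hmem α β, h.add_mul_curveW_ne_zero hsq (Or.inl hα0),
      LeadSystem.hasLead_add hak (hbw hbl)⟩
  · exact Or.inr ⟨k, _, trivial, hmem1 α, hc0,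
      hC.hasLead_add_of_lt (hmem2 β) (hne2 hc0') hak (hbw hbl) hkl⟩

end IsCurve

end Infinity

/-! ### Classification of the places over infinity. -/

section Main

variable {K F : Type*} [Field K] [Field F] [Algebra K F] [Algebra (RatFunc K) F]
  [IsScalarTower K (RatFunc K) F]

/-- As r + 1 is even, q ≡ 1 modulo r + 1 forces q to be odd. -/
theorem two_ne_zero_of_card {K : Type*} [Field K] [Finite K] {r q m : ℕ} (hodd : Odd r)
    (hqr : q ≡ 1 [MOD r + 1]) (hK : Nat.card K = q ^ m) : (2 : K) ≠ 0 := by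
  intro h2
  have hq : Odd q := by
    have : 2 ∣ r + 1 := by
      obtain ⟨k, rfl⟩ := hodd
      exact ⟨k + 1, by ring⟩
    exact Nat.odd_iff.2 (hqr.of_dvd this)
  have hchar : CharP K 2 := CharTwo.of_one_ne_zero_of_two_eq_zero one_ne_zero h2
  have : Fintype K := Fintype.ofFinite K
  obtain ⟨n, -, hn⟩ := FiniteField.card K 2
  rw [← Nat.card_eq_fintype_card, hK] at hn
  have h3 : Even (q ^ m) := by
    rw [hn]
    exact (even_two).pow_of_ne_zero n.ne_zero
  exact Nat.not_even_iff_odd.2 (hq.pow) h3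

theorem adjoin_pair_eq_top {x : F}
    (hF : IntermediateField.adjoin (RatFunc K) {x} = ⊤) :
    IntermediateField.adjoin K {x, algebraMap (RatFunc K) F RatFunc.X} = ⊤ := by
  set L := IntermediateField.adjoin K {x, algebraMap (RatFunc K) F RatFunc.X}
  have hX : ∀ z : RatFunc K, algebraMap (RatFunc K) F z ∈ L := by
    intro z
    have h1 : (⊤ : IntermediateField K (RatFunc K)) ≤
        L.comap (IsScalarTower.toAlgHom K (RatFunc K) F) := by
      rw [← RatFunc.adjoin_X, IntermediateField.adjoin_simple_le_iff]
      exact IntermediateField.subset_adjoin K _ (by simp)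
    exact h1 (show z ∈ ⊤ by trivial)
  have h2 : IntermediateField.adjoin (RatFunc K) {x} ≤ L.toSubfield.toIntermediateField hX := by
    rw [IntermediateField.adjoin_simple_le_iff]
    exact IntermediateField.subset_adjoin K _ (by simp)
  rw [hF] at h2
  exact top_le_iff.1 fun z _ ↦ h2 (show z ∈ ⊤ by trivial)

theorem transcendental_algebraMap_X :
    Transcendental K (algebraMap (RatFunc K) F RatFunc.X) :=
  (transcendental_algebraMap_iff (algebraMap (RatFunc K) F).injective).2 RatFunc.transcendental_X

theorem isCurve_of_root {e : ℕ} (h2 : (2 : K) ≠ 0) {x : F}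
    (hx : aeval x (curvePoly K (2 * e + 3)) = 0)
    (hF : IntermediateField.adjoin (RatFunc K) {x} = ⊤) :
    IsCurve K x (algebraMap (RatFunc K) F RatFunc.X) e := by
  set t := algebraMap (RatFunc K) F RatFunc.X
  have hrel : t ^ (2 * e + 4) * (x * (x - 1)) =
      -(x ^ (2 * e + 4) + 2 * x ^ (e + 2) - x ^ 3 + x ^ 2 + 1) := by
    rw [curvePoly, show (2 * e + 3 + 1) / 2 = e + 2 by omega] at hx
    simp only [map_add, map_sub, map_mul, map_pow, map_one, aeval_X, aeval_C, map_ofNat] at hx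
    linear_combination hx
  -- If x were algebraic over K, so would be t^(2e+4) = -N(x)/(x(x-1)). The denominator is nonzero,
  -- since x = 0 would give 1 = 0 and x = 1 would give 4 = 0.
  refine ⟨h2, fun halg ↦ ?_, adjoin_pair_eq_top hF, hrel⟩
  have h4 : (4 : F) ≠ 0 := by
    have : (4 : F) = algebraMap K F (2 * 2) := by rw [map_mul, map_ofNat]; norm_num
    rw [this]
    exact (_root_.map_ne_zero _).2 (mul_ne_zero h2 h2)
  have hx0 : x ≠ 0 := by
    rintro rfl
    simp at hrel
  have hx1 : x - 1 ≠ 0 := by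
    intro h1
    rw [sub_eq_zero.1 h1] at hrel
    refine h4 ?_
    simp at hrel
    linear_combination hrel
  have hxm : x ∈ algebraicClosure K F := mem_algebraicClosure_iff.2 halg
  have h2m : (2 : F) ∈ algebraicClosure K F := by
    rw [← map_ofNat (algebraMap K F) 2]
    exact IntermediateField.algebraMap_mem _ _
  have ht : t ^ (2 * e + 4) ∈ algebraicClosure K F := by
    rw [eq_div_of_mul_eq (mul_ne_zero hx0 hx1) hrel]
    exact div_mem (neg_mem (add_mem (add_mem (sub_mem (add_mem (pow_mem hxm _)
      (mul_mem h2m (pow_mem hxm _))) (pow_mem hxm _)) (pow_mem hxm _)) (one_mem _)))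
      (mul_mem hxm (sub_mem hxm (one_mem _)))
  exact transcendental_algebraMap_X ((mem_algebraicClosure_iff.1 ht).of_pow (by positivity))

theorem placeAtInfinity.f_eq_one (P : (placeAtInfinity K).Over F)
    (h : ∀ z, P.1.valuationRing.valuation z ≤ 1 →
      ∃ c ∈ (algebraMap K F).range.toAddSubgroup, P.1.valuationRing.valuation (z - c) < 1) :
    P.f = 1 := by
  refine (f_eq P (fun _ : Fin 1 ↦ (1 : F)) (fun _ ↦ one_mem _) ?_ ?_).trans (by simp)
  · intro z hz
    obtain ⟨_, ⟨a, rfl⟩, ha⟩ := h z ((ValuationSubring.valuation_le_one_iff _ _).2 hz)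
    exact ⟨fun _ ↦ a, by simpa using ha⟩
  · intro a ha i
    by_contra h0
    have h1 := ValuationSubring.valuation_algebraMap P.1.algebraMap_mem h0
    rw [Fin.eq_zero i] at h1
    simp [h1] at ha

namespace IsCurve

variable {x : F} {e : ℕ} (h : IsCurve K x (algebraMap (RatFunc K) F RatFunc.X) e)
include h

omit h in
theorem e_eq_f_eq_of_finite {a : K} {P : (placeAtInfinity K).Over F}
    (hC : LeadSystem (valuationRingsAt x a) (algebraMap K F).range.toAddSubgroup
      (algebraMap (RatFunc K) F RatFunc.X))
    (hled : ∀ z : F, Led (valuationRingsAt x a) (algebraMap K F).range.toAddSubgroup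
      (algebraMap (RatFunc K) F RatFunc.X) (fun _ ↦ True) z)
    (hP : P.1.valuationRing ∈ valuationRingsAt x a) : P.e = 1 ∧ P.f = 1 :=
  ⟨placeAtInfinity.e_eq P (hC.one_lt _ hP) (fun _ ↦ hC.valuation_le_inv hled hP) (by simp),
    placeAtInfinity.f_eq_one P fun _ ↦ hC.exists_residue hled hP⟩

theorem e_eq_f_eq_of_split {i : K} (hi : i ^ 2 = -1) {P : (placeAtInfinity K).Over F}
    (hP : P.1.valuationRing ∈ splitPoles x (algebraMap (RatFunc K) F RatFunc.X) e i) :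
    P.e = e + 1 ∧ P.f = 1 :=
  ⟨placeAtInfinity.e_eq P ((h.leadSystem_split hi).one_lt _ hP)
      (fun _ ↦ (h.leadSystem_split hi).valuation_le_inv (h.led_split hi) hP) (h.valuation_t hP.1),
    placeAtInfinity.f_eq_one P fun _ ↦
      (h.leadSystem_split hi).exists_residue (h.led_split hi) hP⟩

theorem e_eq_f_eq_of_nonsplit (hsq : ¬ IsSquare (-1 : K)) {P : (placeAtInfinity K).Over F}
    (hP : P.1.valuationRing ∈ valuationRingsAt x⁻¹ (0 : K)) : P.e = e + 1 ∧ P.f = 2 := by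
  have hC := h.leadSystem_nonsplit hsq fun O hO ↦ h.one_lt_valuation_div hO
  have hled := h.led_nonsplit hsq
  refine ⟨placeAtInfinity.e_eq P (hC.one_lt _ hP) (fun _ ↦ hC.valuation_le_inv hled hP)
    (h.valuation_t hP), ?_⟩
  refine (placeAtInfinity.f_eq P ![1, curveW x (algebraMap (RatFunc K) F RatFunc.X) e]
    ?_ ?_ ?_).trans (by simp)
  · rw [Fin.forall_fin_two]
    exact ⟨one_mem _, (ValuationSubring.valuation_le_one_iff _ _).1 (h.valuation_curveW hP).le⟩
  · intro z hz
    obtain ⟨c, hc, hzc⟩ := hC.exists_residue hled hP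
      ((ValuationSubring.valuation_le_one_iff _ _).2 hz)
    obtain ⟨a, b, rfl⟩ := mem_constAddMul.1 hc
    exact ⟨![a, b], by simpa [Fin.sum_univ_two] using hzc⟩
  · intro a ha
    have ha' : P.1.valuationRing.valuation (algebraMap K F (a 0) +
        algebraMap K F (a 1) * curveW x (algebraMap (RatFunc K) F RatFunc.X) e) < 1 := by
      simpa [Fin.sum_univ_two] using ha
    rw [Fin.forall_fin_two]
    by_contra hne
    have hab : a 0 ≠ 0 ∨ a 1 ≠ 0 := by tauto
    exact ha'.ne (h.valuation_add_mul_curveW hsq hP hab)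

/-- Otherwise x is integral while x and x - 1 have value at least 1, so t^(2e+4) x(x-1) has value
greater than 1 although it equals the integral element -N(x). -/
theorem valuationRing_mem (P : (placeAtInfinity K).Over F) :
    P.1.valuationRing ∈ valuationRingsAt x (0 : K) ∨
      P.1.valuationRing ∈ valuationRingsAt x (1 : K) ∨
      P.1.valuationRing ∈ valuationRingsAt x⁻¹ (0 : K) := by
  have hK := P.1.algebraMap_mem
  set t := algebraMap (RatFunc K) F RatFunc.X
  set O := P.1.valuationRing
  have ht : 1 < O.valuation t := (placeAtInfinity.liesOver_iff P.1).1 P.2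
  by_contra! hcon
  obtain ⟨h0, h1, h2⟩ := hcon
  have hx0 : 1 ≤ O.valuation x := by
    by_contra! hlt
    exact h0 ⟨hK, by simpa using hlt⟩
  have hx1 : 1 ≤ O.valuation (x - 1) := by
    by_contra! hlt
    exact h1 ⟨hK, by simpa using hlt⟩
  have hx : O.valuation x ≤ 1 := by
    by_contra! hlt
    exact h2 ⟨hK, by simpa using inv_lt_one_of_one_lt₀ hlt⟩
  have hA := ValuationSubring.valuation_aeval_le_one hK ((O.valuation_le_one_iff x).1 hx)
    (curveNumerator K e)
  have hrel := congrArg O.valuation h.rel_zero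
  rw [Valuation.map_neg] at hrel
  rw [← hrel, map_mul, map_mul, map_pow] at hA
  have hlt : 1 < O.valuation t ^ (2 * e + 4) := one_lt_pow₀ ht (by omega)
  refine (hlt.trans_le ?_).not_ge hA
  refine le_mul_of_one_le_right' (one_le_mul ?_ ?_)
  · simpa using hx0
  · simpa using hx1

omit h [Algebra (RatFunc K) F] [IsScalarTower K (RatFunc K) F] in
theorem notMem_valuationRingsAt {x : F} {a b : K} (hab : a ≠ b) {O : ValuationSubring F}
    (ha : O ∈ valuationRingsAt x a) : O ∉ valuationRingsAt x b := by
  intro hb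
  have h1 := O.valuation.map_sub_lt hb.2 ha.2
  rw [sub_sub_sub_cancel_left, ← map_sub,
    ValuationSubring.valuation_algebraMap ha.1 (sub_ne_zero.2 hab)] at h1
  exact lt_irrefl _ h1

omit [IsScalarTower K (RatFunc K) F] in
theorem notMem_valuationRingsAt_of_inv {a : K} {O : ValuationSubring F}
    (hO : O ∈ valuationRingsAt x⁻¹ (0 : K)) : O ∉ valuationRingsAt x a := by
  intro ha
  have h1 := (O.valuation_le_one_iff _).2
    (ValuationSubring.mem_of_valuation_sub_lt_one (hO.1 a) ha.2)
  exact (h.one_lt_valuation_x hO).not_ge h1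

omit h [Algebra (RatFunc K) F] [IsScalarTower K (RatFunc K) F] in
theorem notMem_splitPoles {x t : F} {i j : K} (hij : i ≠ j) {O : ValuationSubring F}
    (hi : O ∈ splitPoles x t e i) : O ∉ splitPoles x t e j := fun hj ↦
  notMem_valuationRingsAt hij (x := curveW x t e) ⟨hi.1.1, hi.2⟩ ⟨hi.1.1, hj.2⟩

omit [IsScalarTower K (RatFunc K) F] in
theorem mem_splitPoles {i : K} (hi : i ^ 2 = -1) {O : ValuationSubring F}
    (hO : O ∈ valuationRingsAt x⁻¹ (0 : K)) :
    O ∈ splitPoles x (algebraMap (RatFunc K) F RatFunc.X) e i ∨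
      O ∈ splitPoles x (algebraMap (RatFunc K) F RatFunc.X) e (-i) := by
  have h1 := h.valuation_curveW_sq_add_one_lt_one hO
  set w := curveW x (algebraMap (RatFunc K) F RatFunc.X) e
  have h2 : w ^ 2 + 1 = (w - algebraMap K F i) * (w - algebraMap K F (-i)) := by
    have := congrArg (algebraMap K F) hi
    simp only [map_pow, map_neg, map_one] at this ⊢
    linear_combination this
  rw [h2, map_mul] at h1
  by_contra! hcon
  have h3 : 1 ≤ O.valuation (w - algebraMap K F i) := not_lt.1 fun hlt ↦ hcon.1 ⟨hO, hlt⟩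
  have h4 : 1 ≤ O.valuation (w - algebraMap K F (-i)) := not_lt.1 fun hlt ↦ hcon.2 ⟨hO, hlt⟩
  exact (one_le_mul h3 h4).not_gt h1

omit [IsScalarTower K (RatFunc K) F] in
theorem one_lt_valuation_of_inv {O : ValuationSubring F}
    (hO : O ∈ valuationRingsAt x⁻¹ (0 : K)) :
    1 < O.valuation (algebraMap (RatFunc K) F RatFunc.X) := by
  rw [h.valuation_t hO]
  exact one_lt_pow₀ (h.one_lt_valuation_div hO) (by omega)

omit h [IsScalarTower K (RatFunc K) F] in
theorem over_eq_of_valuationRing_eq {P P' : (placeAtInfinity K).Over F}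
    (hP : P.1.valuationRing = P'.1.valuationRing) : P = P' :=
  Subtype.ext (Place.ext hP)

end IsCurve

end Main

theorem mainTheorem6 (r q m : ℕ) (hr : 3 ≤ r) (hodd : Odd r) (hq : IsPrimePow q)
    (hqr : q ≡ 1 [MOD r + 1]) (hm : 1 ≤ m)
    (K : Type*) [Field K] [Finite K] (hK : Nat.card K = q ^ m)
    (F : Type*) [Field F] [Algebra K F] [Algebra (RatFunc K) F] [IsScalarTower K (RatFunc K) F]
    (x : F) (hx : Polynomial.aeval x (curvePoly K r) = 0)
    (hF : IntermediateField.adjoin (RatFunc K) {x} = ⊤) :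
    (IsSquare (-1 : K) →
      ∃ P₁ P₂ P₃ P₄ : (placeAtInfinity K).Over F,
        [P₁, P₂, P₃, P₄].Nodup ∧
        (∀ P : (placeAtInfinity K).Over F, P = P₁ ∨ P = P₂ ∨ P = P₃ ∨ P = P₄) ∧
        (P₁.e = 1 ∧ P₁.f = 1) ∧
        (P₂.e = 1 ∧ P₂.f = 1) ∧
        (P₃.e = (r - 1) / 2 ∧ P₃.f = 1) ∧
        (P₄.e = (r - 1) / 2 ∧ P₄.f = 1)) ∧
    (¬ IsSquare (-1 : K) →
      ∃ P₁ P₂ P₃ : (placeAtInfinity K).Over F,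
        [P₁, P₂, P₃].Nodup ∧
        (∀ P : (placeAtInfinity K).Over F, P = P₁ ∨ P = P₂ ∨ P = P₃) ∧
        (P₁.e = 1 ∧ P₁.f = 1) ∧
        (P₂.e = 1 ∧ P₂.f = 1) ∧
        (P₃.e = (r - 1) / 2 ∧ P₃.f = 2)) := by
  have h2 : (2 : K) ≠ 0 := two_ne_zero_of_card hodd hqr hK
  obtain ⟨e, rfl⟩ : ∃ e, r = 2 * e + 3 := by
    obtain ⟨k, rfl⟩ := hodd
    -- Here r = 2k + 1, and 3 ≤ r gives k ≥ 1, so the natural subtraction is exact.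
    exact ⟨k - 1, by omega⟩
  have h : IsCurve K x (algebraMap (RatFunc K) F RatFunc.X) e := isCurve_of_root h2 hx hF
  rw [show (2 * e + 3 - 1) / 2 = e + 1 by omega]
  obtain ⟨O₁, hO₁⟩ := h.leadSystem_zero.nonempty
  obtain ⟨O₂, hO₂⟩ := h.leadSystem_one.nonempty
  let P₁ := placeAtInfinity.overOfPole O₁ hO₁.1 (h.leadSystem_zero.one_lt _ hO₁)
  let P₂ := placeAtInfinity.overOfPole O₂ hO₂.1 (h.leadSystem_one.one_lt _ hO₂)
  have h12 : O₁ ≠ O₂ := by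
    rintro rfl
    exact IsCurve.notMem_valuationRingsAt zero_ne_one hO₁ hO₂
  have hP₁ : P₁.e = 1 ∧ P₁.f = 1 := IsCurve.e_eq_f_eq_of_finite h.leadSystem_zero h.led_zero hO₁
  have hP₂ : P₂.e = 1 ∧ P₂.f = 1 := IsCurve.e_eq_f_eq_of_finite h.leadSystem_one h.led_one hO₂
  have hne : ∀ {P P' : (placeAtInfinity K).Over F},
      P.1.valuationRing ≠ P'.1.valuationRing → P ≠ P' := by
    rintro P _ hPP rfl
    exact hPP rfl
  constructor
  · rintro ⟨i, hi⟩
    have hi' : i ^ 2 = -1 := by rw [hi, sq]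
    have hi'' : (-i) ^ 2 = -1 := by rw [neg_sq, hi']
    have hii : i ≠ -i := by
      intro h0
      have : 2 * i = 0 := by linear_combination h0
      rcases mul_eq_zero.1 this with h0 | rfl
      · exact h2 h0
      · simp at hi
    obtain ⟨O₃, hO₃⟩ := (h.leadSystem_split hi').nonempty
    obtain ⟨O₄, hO₄⟩ := (h.leadSystem_split hi'').nonempty
    let P₃ := placeAtInfinity.overOfPole O₃ hO₃.1.1 (h.one_lt_valuation_of_inv hO₃.1)
    let P₄ := placeAtInfinity.overOfPole O₄ hO₄.1.1 (h.one_lt_valuation_of_inv hO₄.1)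
    have h13 : O₁ ≠ O₃ := by rintro rfl; exact h.notMem_valuationRingsAt_of_inv hO₃.1 hO₁
    have h14 : O₁ ≠ O₄ := by rintro rfl; exact h.notMem_valuationRingsAt_of_inv hO₄.1 hO₁
    have h23 : O₂ ≠ O₃ := by rintro rfl; exact h.notMem_valuationRingsAt_of_inv hO₃.1 hO₂
    have h24 : O₂ ≠ O₄ := by rintro rfl; exact h.notMem_valuationRingsAt_of_inv hO₄.1 hO₂
    have h34 : O₃ ≠ O₄ := by rintro rfl; exact IsCurve.notMem_splitPoles hii hO₃ hO₄
    refine ⟨P₁, P₂, P₃, P₄, ?_, ?_, hP₁, hP₂, h.e_eq_f_eq_of_split hi' hO₃,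
      h.e_eq_f_eq_of_split hi'' hO₄⟩
    · have n12 : P₁ ≠ P₂ := hne h12
      have n13 : P₁ ≠ P₃ := hne h13
      have n14 : P₁ ≠ P₄ := hne h14
      have n23 : P₂ ≠ P₃ := hne h23
      have n24 : P₂ ≠ P₄ := hne h24
      have n34 : P₃ ≠ P₄ := hne h34
      simp [n12, n13, n14, n23, n24, n34]
    · intro P
      rcases h.valuationRing_mem P with hP | hP | hP
      · exact Or.inl (IsCurve.over_eq_of_valuationRing_eq
          (h.leadSystem_zero.eq_of_mem h.led_zero hP hO₁))
      · exact Or.inr (Or.inl (IsCurve.over_eq_of_valuationRing_eq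
          (h.leadSystem_one.eq_of_mem h.led_one hP hO₂)))
      · rcases h.mem_splitPoles hi' hP with hP | hP
        · exact Or.inr (Or.inr (Or.inl (IsCurve.over_eq_of_valuationRing_eq
            ((h.leadSystem_split hi').eq_of_mem (h.led_split hi') hP hO₃))))
        · exact Or.inr (Or.inr (Or.inr (IsCurve.over_eq_of_valuationRing_eq
            ((h.leadSystem_split hi'').eq_of_mem (h.led_split hi'') hP hO₄))))
  · intro hsq
    have hC := h.leadSystem_nonsplit hsq fun O hO ↦ h.one_lt_valuation_div hO
    obtain ⟨O₃, hO₃⟩ := hC.nonempty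
    let P₃ := placeAtInfinity.overOfPole O₃ hO₃.1 (h.one_lt_valuation_of_inv hO₃)
    have h13 : O₁ ≠ O₃ := by rintro rfl; exact h.notMem_valuationRingsAt_of_inv hO₃ hO₁
    have h23 : O₂ ≠ O₃ := by rintro rfl; exact h.notMem_valuationRingsAt_of_inv hO₃ hO₂
    refine ⟨P₁, P₂, P₃, ?_, ?_, hP₁, hP₂, h.e_eq_f_eq_of_nonsplit hsq hO₃⟩
    · have n12 : P₁ ≠ P₂ := hne h12
      have n13 : P₁ ≠ P₃ := hne h13
      have n23 : P₂ ≠ P₃ := hne h23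
      simp [n12, n13, n23]
    · intro P
      rcases h.valuationRing_mem P with hP | hP | hP
      · exact Or.inl (IsCurve.over_eq_of_valuationRing_eq
          (h.leadSystem_zero.eq_of_mem h.led_zero hP hO₁))
      · exact Or.inr (Or.inl (IsCurve.over_eq_of_valuationRing_eq
          (h.leadSystem_one.eq_of_mem h.led_one hP hO₂)))
      · exact Or.inr (Or.inr (IsCurve.over_eq_of_valuationRing_eq
          (hC.eq_of_mem (h.led_nonsplit hsq) hP hO₃)))
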